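/- Let $N\ge 1$, let $\Omega\subset\mathbb R^N$ be a bounded domain (nonempty, open, connected) with boundary of class $C^2$, let $p\ge 2$ and $q>p$, and set $r:=q/(q-p)$. Given $u_0\in C(\bar\Omega)$ with $u_0\ge 0$ and $u_0=0$ on $\partial\Omega$, consider the problem $$\partial_t u-\operatorname{div}\left(|\nabla u|^{p-2}\nabla u\right)=|\nabla u|^q \ \text{ in } (0,\infty)\times\Omega,\qquad u=0\ \text{ on } (0,\infty)\times\partial\Omega,\qquad u(0)=u_0\ \text{ in } \Omega. \tag{P}$$ A global weak solution to (P) is a nonnegative function $u\in C([0,\infty)\times\bar\Omega)$ with $u=0$ on $(0,\infty)\times\partial\Omega$ and $u(0)=u_0$ in $\Omega$, which belongs to $L^\infty(0,T;W^{1,\infty}(\Omega))$ for every $T>0$ and satisfies, for every $\psi\in H^1_0(\Omega)$ and every $T>0$, $$\frac{d}{dt}\int_\Omega u(t,x)\,\psi(x)\,dx=\int_\Omega\left(-|\nabla u(t,x)|^{p-2}\,\nabla u(t,x)\cdot\nabla\psi(x)+|\nabla u(t,x)|^q\,\psi(x)\right)dx$$ on $(0,T)$, in the sense that $t\mapsto\int_\Omega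 u(t,x)\psi(x)\,dx$ is absolutely continuous on $[0,T]$ and the identity holds for almost every $t\in(0,T)$. There is a real number $\kappa>0$, depending only on $\Omega$, $p$ and $q$, such that, for every $u_0$ as above with $\|u_0\|_{L^{r+1}(\Omega)}>\kappa$, the problem (P) has no global weak solution. -/

import Mathlib

open MeasureTheory Set Filter Topology Function
open scoped ContDiff

noncomputable section

namespace GradSource

/-- `ℝ^N` with its Euclidean norm. -/
abbrev E (N : ℕ) : Type := EuclideanSpace ℝ (Fin N)

/-- `Ω` has a boundary of class `C²`: near each boundary point, `Ω` is the set where a `C²` function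
with nonvanishing differential at that point is negative. -/
def HasC2Boundary {N : ℕ} (Ω : Set (E N)) : Prop :=
  ∀ x₀ ∈ frontier Ω, ∃ (U : Set (E N)) (g : E N → ℝ),
    IsOpen U ∧ x₀ ∈ U ∧ ContDiffOn ℝ 2 g U ∧ fderiv ℝ g x₀ ≠ 0 ∧ ∀ x ∈ U, (x ∈ Ω ↔ g x < 0)

/-- A test function on `Ω`: an element of `C_c^∞(Ω)`. -/
def IsTestFunction {N : ℕ} (Ω : Set (E N)) (φ : E N → ℝ) : Prop :=
  ContDiff ℝ ∞ φ ∧ HasCompactSupport φ ∧ tsupport φ ⊆ Ω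

/-- `G` is the weak (distributional) gradient of `v` on the open set `Ω`. -/
def IsWeakGradient {N : ℕ} (Ω : Set (E N)) (v : E N → ℝ) (G : E N → E N) : Prop :=
  LocallyIntegrableOn v Ω ∧ LocallyIntegrableOn G Ω ∧
    ∀ φ : E N → ℝ, IsTestFunction Ω φ →
      ∫ x in Ω, v x • gradient φ x = - ∫ x in Ω, φ x • G x

/-- `ψ ∈ H¹₀(Ω)` with gradient `Dψ`: the pair `(ψ, Dψ)` lies in the closure of
`{(φ, ∇φ) : φ ∈ C_c^∞(Ω)}` in `L²(Ω) × L²(Ω; ℝ^N)`. -/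
def MemH10 {N : ℕ} (Ω : Set (E N)) (ψ : E N → ℝ) (Dψ : E N → E N) : Prop :=
  MemLp ψ 2 (volume.restrict Ω) ∧ MemLp Dψ 2 (volume.restrict Ω) ∧
    ∃ φ : ℕ → E N → ℝ, (∀ n, IsTestFunction Ω (φ n)) ∧
      Tendsto (fun n => eLpNorm (fun x => φ n x - ψ x) 2 (volume.restrict Ω)) atTop (𝓝 0) ∧
      Tendsto (fun n => eLpNorm (fun x => gradient (φ n) x - Dψ x) 2 (volume.restrict Ω))
        atTop (𝓝 0)

/-- `u ∈ L^∞(0,T; W^{1,∞}(Ω))` for all `T > 0`, where `Du` is the spatial gradient of `u`. -/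
def MemLinftyW1infty {N : ℕ} (Ω : Set (E N)) (u : ℝ → E N → ℝ) (Du : ℝ → E N → E N) : Prop :=
  AEStronglyMeasurable (uncurry u) (volume.restrict (Ioi (0 : ℝ) ×ˢ Ω)) ∧
  AEStronglyMeasurable (uncurry Du) (volume.restrict (Ioi (0 : ℝ) ×ˢ Ω)) ∧
  ∀ T : ℝ, 0 < T → ∃ M : ℝ, ∀ᵐ t ∂(volume.restrict (Ioo 0 T)),
    IsWeakGradient Ω (u t) (Du t) ∧ ∀ᵐ x ∂(volume.restrict Ω), |u t x| ≤ M ∧ ‖Du t x‖ ≤ M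

/-- `u` is a global weak solution of `∂ₜu - div(|∇u|^{p-2}∇u) = |∇u|^q` in `(0,∞) × Ω` with `u = 0`
on `(0,∞) × ∂Ω` and `u(0) = u₀`. The identity for `d/dt ∫ u ψ` is understood in the usual sense:
`t ↦ ∫ u(t) ψ` is absolutely continuous on `[0,T]` for all `T` and its derivative is given by the
right-hand side for almost every `t`. -/
def IsGlobalWeakSolution {N : ℕ} (Ω : Set (E N)) (p q : ℝ) (u₀ : E N → ℝ)
    (u : ℝ → E N → ℝ) : Prop :=
  ContinuousOn (uncurry u) (Ici (0 : ℝ) ×ˢ closure Ω) ∧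
  (∀ t, 0 ≤ t → ∀ x ∈ closure Ω, 0 ≤ u t x) ∧
  (∀ t, 0 < t → ∀ x ∈ frontier Ω, u t x = 0) ∧
  (∀ x ∈ Ω, u 0 x = u₀ x) ∧
  ∃ Du : ℝ → E N → E N, MemLinftyW1infty Ω u Du ∧
    ∀ (ψ : E N → ℝ) (Dψ : E N → E N), MemH10 Ω ψ Dψ → ∀ T : ℝ, 0 < T →
      AbsolutelyContinuousOnInterval (fun t => ∫ x in Ω, u t x * ψ x) 0 T ∧
      ∀ᵐ t ∂(volume.restrict (Ioo 0 T)),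
        HasDerivAt (fun s => ∫ x in Ω, u s x * ψ x)
          (∫ x in Ω, (- (‖Du t x‖ ^ (p - 2) * inner ℝ (Du t x) (Dψ x)) + ‖Du t x‖ ^ q * ψ x)) t

end GradSource

end

/-!
Nonexistence comes from testing the equation with `u ^ r`, where `r = q / (q - p)`. Formally,
`(r + 1)⁻¹ d/dt ∫ u ^ (r + 1) = -r ∫ u ^ (r - 1) |∇u| ^ p + ∫ u ^ r |∇u| ^ q`. Since
`r - 1 = r p / q`, Young's inequality (`mul_rpow_mul_rpow_le`) absorbs the first term into half of
the second one up to a constant. An integration by parts against a coordinate function gives the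
weighted Poincaré inequality `∫ u ^ (r + q) ≤ C ∫ u ^ r |∇u| ^ q` (`IsSlice.integral_rpow_le`), so
`Y = (r + 1)⁻¹ ∫ u ^ (r + 1)` satisfies `Y' ≥ c Y ^ γ - K` with `γ = 1 + (q - 1) / (r + 1) > 1`, and
it blows up in finite time as soon as `Y 0` is large (`blowup`).

Two points need care, as a weak solution has no time derivative and `u ^ r` is a test function that
depends on time.

* For almost every `t` the function `u(t) ^ r` belongs to `H¹₀(Ω)` (`IsSlice.memH10_rpow`): `u(t)` is
  continuous and vanishes on the boundary, so that mollifying `u(t)` and composing with a smooth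
  function that vanishes near zero gives compactly supported smooth approximations.
* The energy inequality (`energy_inequality`) is obtained from increments. By convexity
  `Y (t + h) - Y t ≥ ∫ (u(t + h) - u(t)) u(t) ^ r`, and the right-hand side is given by the weak
  formulation with the fixed test function `u(t) ^ r`. It mixes the gradients at time `t` and at times
  `s ∈ (t, t + h)`, but Young's inequality separates them, and `u(t) ^ r` may be replaced by
  `u(s) ^ r` by uniform continuity. Averaging over `t` and letting `h → 0` needs only the continuity
  of `Y` (`integral_le_sub_of_ae_difference`).
-/

namespace GradSource

variable {N : ℕ}

/-! ### Convergence in `L²` and closedness of `H¹₀` -/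

/-- Bounded a.e. convergence on a finite measure space implies convergence in `L²`. -/
theorem tendsto_eLpNorm_two_of_bounded {α : Type*} [MeasurableSpace α] {μ : Measure α}
    [IsFiniteMeasure μ] {F : Type*} [NormedAddCommGroup F] {f : ℕ → α → F} {g : α → F} {C : ℝ}
    (hf : ∀ n, AEStronglyMeasurable (f n) μ) (hg : AEStronglyMeasurable g μ)
    (hC : ∀ᶠ n in atTop, ∀ᵐ x ∂μ, ‖f n x - g x‖ ≤ C)
    (hlim : ∀ᵐ x ∂μ, Tendsto (fun n => f n x) atTop (𝓝 (g x))) :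
    Tendsto (fun n => eLpNorm (fun x => f n x - g x) 2 μ) atTop (𝓝 0) := by
  have h1 : Tendsto (fun n => ∫⁻ x, ‖f n x - g x‖ₑ ^ (2 : ℝ) ∂μ) atTop (𝓝 (∫⁻ _, 0 ∂μ)) := by
    refine tendsto_lintegral_filter_of_dominated_convergence' (fun _ => ENNReal.ofReal C ^ (2 : ℝ))
      (Eventually.of_forall fun n => ((hf n).sub hg).enorm.pow_const _) ?_ ?_ ?_
    · filter_upwards [hC] with n hn
      filter_upwards [hn] with x hx
      gcongr
      rw [← ofReal_norm]
      exact ENNReal.ofReal_le_ofReal hx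
    · rw [lintegral_const]
      finiteness
    · filter_upwards [hlim] with x hx
      have h2 : Tendsto (fun n => f n x - g x) atTop (𝓝 0) := by
        simpa using hx.sub_const (g x)
      have h3 := (h2.enorm).ennrpow_const (2 : ℝ)
      simpa using h3
  have h2 := h1.ennrpow_const (1 / 2 : ℝ)
  simp only [lintegral_zero] at h2
  rw [ENNReal.zero_rpow_of_pos (by norm_num)] at h2
  refine h2.congr fun n => ?_
  rw [eLpNorm_eq_lintegral_rpow_enorm_toReal (by norm_num) (by norm_num)]
  simp

theorem IsTestFunction.continuous_gradient {Ω : Set (E N)} {φ : E N → ℝ}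
    (h : IsTestFunction Ω φ) : Continuous (gradient φ) := by
  have h1 : Continuous (fderiv ℝ φ) := h.1.continuous_fderiv (by simp)
  exact (InnerProductSpace.toDual ℝ (E N)).symm.continuous.comp h1

/-- `H¹₀(Ω)` is closed under `L²` convergence of functions and gradients. -/
theorem MemH10.of_tendsto {Ω : Set (E N)} {ψ : E N → ℝ} {Dψ : E N → E N}
    {f : ℕ → E N → ℝ} {Df : ℕ → E N → E N} (hf : ∀ n, MemH10 Ω (f n) (Df n))
    (hψ : MemLp ψ 2 (volume.restrict Ω)) (hDψ : MemLp Dψ 2 (volume.restrict Ω))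
    (h0 : Tendsto (fun n => eLpNorm (fun x => f n x - ψ x) 2 (volume.restrict Ω)) atTop (𝓝 0))
    (h1 : Tendsto (fun n => eLpNorm (fun x => Df n x - Dψ x) 2 (volume.restrict Ω))
      atTop (𝓝 0)) : MemH10 Ω ψ Dψ := by
  refine ⟨hψ, hDψ, ?_⟩
  have key : ∀ n : ℕ, ∃ φ : E N → ℝ, IsTestFunction Ω φ ∧
      eLpNorm (fun x => φ x - f n x) 2 (volume.restrict Ω) ≤ (n : ENNReal)⁻¹ ∧
      eLpNorm (fun x => gradient φ x - Df n x) 2 (volume.restrict Ω) ≤ (n : ENNReal)⁻¹ := by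
    intro n
    obtain ⟨-, -, φ, hφ, a, b⟩ := hf n
    have hn : (0 : ENNReal) < (n : ENNReal)⁻¹ := by simp
    obtain ⟨k, hk1, hk2⟩ := ((a.eventually_le_const hn).and (b.eventually_le_const hn)).exists
    exact ⟨φ k, hφ k, hk1, hk2⟩
  choose φ hφ a b using key
  refine ⟨φ, hφ, ?_, ?_⟩
  · have h2 := ENNReal.tendsto_inv_nat_nhds_zero.add h0
    rw [add_zero] at h2
    refine tendsto_of_tendsto_of_tendsto_of_le_of_le tendsto_const_nhds h2 (fun _ => zero_le)
      fun n => ?_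
    have e : (fun x => φ n x - ψ x) = (fun x => φ n x - f n x) + fun x => f n x - ψ x := by
      ext x; simp
    rw [e]
    refine (eLpNorm_add_le ?_ ?_ (by norm_num)).trans (add_le_add (a n) le_rfl)
    · exact (hφ n).1.continuous.aestronglyMeasurable.sub (hf n).1.1
    · exact (hf n).1.1.sub hψ.1
  · have h2 := ENNReal.tendsto_inv_nat_nhds_zero.add h1
    rw [add_zero] at h2
    refine tendsto_of_tendsto_of_tendsto_of_le_of_le tendsto_const_nhds h2 (fun _ => zero_le)
      fun n => ?_
    have e : (fun x => gradient (φ n) x - Dψ x)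
        = (fun x => gradient (φ n) x - Df n x) + fun x => Df n x - Dψ x := by
      ext x; simp
    rw [e]
    refine (eLpNorm_add_le ?_ ?_ (by norm_num)).trans (add_le_add (b n) le_rfl)
    · exact (hφ n).continuous_gradient.aestronglyMeasurable.sub (hf n).2.1.1
    · exact (hf n).2.1.1.sub hDψ.1

/-! ### Time slices and their mollification -/

/-- `v` is a nonnegative function in `W^{1,∞}(Ω)`, continuous up to the boundary and vanishing
there, with weak gradient `G`, and both `v` and `‖G‖` are bounded by `M`. These are the properties
of almost every time slice of a weak solution. -/
structure IsSlice (Ω : Set (E N)) (M : ℝ) (v : E N → ℝ) (G : E N → E N) : Prop where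
  continuousOn : ContinuousOn v (closure Ω)
  nonneg : ∀ x ∈ closure Ω, 0 ≤ v x
  eq_zero : ∀ x ∈ frontier Ω, v x = 0
  isWeakGradient : IsWeakGradient Ω v G
  le : ∀ x ∈ closure Ω, v x ≤ M
  norm_le : ∀ᵐ x ∂(volume.restrict Ω), ‖G x‖ ≤ M

/-- Extension by zero of a function vanishing on the boundary. -/
theorem continuous_indicator_of_eq_zero_frontier {Ω : Set (E N)} {v : E N → ℝ}
    (hc : ContinuousOn v (closure Ω)) (h0 : ∀ x ∈ frontier Ω, v x = 0) :
    Continuous (Ω.indicator v) := by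
  classical
  have : Ω.indicator v = Ω.piecewise v 0 := by simp
  rw [this]
  exact continuous_piecewise (by simpa using h0) hc continuousOn_const

theorem hasCompactSupport_indicator {Ω : Set (E N)} (hΩb : Bornology.IsBounded Ω) (v : E N → ℝ) :
    HasCompactSupport (Ω.indicator v) :=
  HasCompactSupport.of_support_subset_isCompact hΩb.isCompact_closure
    ((support_indicator_subset).trans subset_closure)

namespace IsSlice

variable {Ω : Set (E N)} {M : ℝ} {v : E N → ℝ} {G : E N → E N}

theorem continuous_indicator (h : IsSlice Ω M v G) : Continuous (Ω.indicator v) :=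
  continuous_indicator_of_eq_zero_frontier h.continuousOn h.eq_zero

theorem aestronglyMeasurable_gradient (h : IsSlice Ω M v G) :
    AEStronglyMeasurable G (volume.restrict Ω) :=
  h.isWeakGradient.2.1.aestronglyMeasurable

theorem aestronglyMeasurable (h : IsSlice Ω M v G) :
    AEStronglyMeasurable v (volume.restrict Ω) :=
  h.isWeakGradient.1.aestronglyMeasurable

theorem integrableOn_gradient (h : IsSlice Ω M v G) (hΩb : Bornology.IsBounded Ω) :
    IntegrableOn G Ω :=
  have : IsFiniteMeasure (volume.restrict Ω) := ⟨by simpa using hΩb.measure_lt_top⟩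
  Integrable.of_bound h.aestronglyMeasurable_gradient M h.norm_le

theorem integrable_indicator_gradient (h : IsSlice Ω M v G) (hΩo : IsOpen Ω)
    (hΩb : Bornology.IsBounded Ω) : Integrable (Ω.indicator G) :=
  (integrable_indicator_iff hΩo.measurableSet).2 (h.integrableOn_gradient hΩb)

/-- Mollification commutes with the weak gradient at points of `Ω` farther from the boundary than
the radius of the mollifier. -/
theorem hasGradientAt_convolution (h : IsSlice Ω M v G) (hΩo : IsOpen Ω)
    (hΩb : Bornology.IsBounded Ω) (ρ : ContDiffBump (0 : E N)) {x : E N}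
    (hx : Metric.closedBall x ρ.rOut ⊆ Ω) :
    HasGradientAt (convolution (ρ.normed volume) (Ω.indicator v)
        (ContinuousLinearMap.lsmul ℝ ℝ) volume)
      (convolution (ρ.normed volume) (Ω.indicator G)
        (ContinuousLinearMap.lsmul ℝ ℝ) volume x) x := by
  set k := ρ.normed volume with hk
  have hkc : HasCompactSupport k := ρ.hasCompactSupport_normed
  have hks : ContDiff ℝ ∞ k := ρ.contDiff_normed
  have hVc := h.continuous_indicator
  have hVi : Integrable (Ω.indicator v) :=
    hVc.integrable_of_hasCompactSupport (hasCompactSupport_indicator hΩb v)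
  have key := hkc.hasFDerivAt_convolution_left (ContinuousLinearMap.lsmul ℝ ℝ)
    (hks.of_le (by exact_mod_cast le_top)) hVi.locallyIntegrable (μ := volume) x
  rw [hasGradientAt_iff_hasFDerivAt]
  refine key.congr_fderiv ?_
  -- the reflected mollifier is an admissible test function
  set φ : E N → ℝ := fun y => k (x - y) with hφ
  have hφg : ∀ y, gradient φ y = - gradient k (x - y) := by
    intro y
    have h1 : HasFDerivAt k (fderiv ℝ k (x - y)) (x - y) :=
      (hks.differentiable (by simp) _).hasFDerivAt
    have h2 : HasFDerivAt (fun y : E N => x - y) (-ContinuousLinearMap.id ℝ (E N)) y := by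
      simpa using (hasFDerivAt_id y).const_sub x
    have h3 := h1.comp y h2
    apply HasGradientAt.gradient
    rw [hasGradientAt_iff_hasFDerivAt]
    refine h3.congr_fderiv ?_
    ext w
    simp
  have hφs : tsupport φ ⊆ Metric.closedBall x ρ.rOut := by
    apply closure_minimal _ Metric.isClosed_closedBall
    intro y hy
    have h1 : x - y ∈ support k := hy
    rw [ρ.support_normed_eq] at h1
    rw [mem_ball_zero_iff] at h1
    rw [Metric.mem_closedBall, dist_comm, dist_eq_norm]
    exact h1.le
  have hφt : IsTestFunction Ω φ :=
    ⟨hks.comp (contDiff_const.sub contDiff_id),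
      HasCompactSupport.of_support_subset_isCompact (isCompact_closedBall x ρ.rOut)
        (subset_closure.trans hφs), hφs.trans hx⟩
  have hw := h.isWeakGradient.2.2 φ hφt
  have e1 : convolution k (Ω.indicator G) (ContinuousLinearMap.lsmul ℝ ℝ) volume x
      = ∫ y in Ω, φ y • G y := by
    rw [convolution_eq_swap, ← integral_indicator hΩo.measurableSet]
    congr 1
    ext1 y
    by_cases hy : y ∈ Ω <;> simp [hy, hφ]
  rw [e1]
  have e2 : (convolution (fderiv ℝ k) (Ω.indicator v)
      (ContinuousLinearMap.precompL (E N) (ContinuousLinearMap.lsmul ℝ ℝ)) volume x)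
      = ∫ y, (Ω.indicator v y) • fderiv ℝ k (x - y) := by
    rw [convolution_eq_swap]
    congr 1
    ext y w
    simp [mul_comm]
  have e3 : ∫ y, (Ω.indicator v y) • fderiv ℝ k (x - y)
      = InnerProductSpace.toDual ℝ (E N) (-∫ y in Ω, v y • gradient φ y) := by
    rw [← integral_neg, ← integral_indicator hΩo.measurableSet]
    rw [← LinearIsometryEquiv.coe_toContinuousLinearEquiv]
    erw [← ContinuousLinearEquiv.integral_comp_comm]
    congr 1
    ext1 y
    by_cases hy : y ∈ Ω
    · simp [hy, hφg, toDual_gradient]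
    · simp [hy]
  rw [e2, e3, hw, neg_neg]

end IsSlice

namespace IsSlice

variable {Ω : Set (E N)} {M : ℝ} {v : E N → ℝ} {G : E N → E N}

theorem norm_convolution_gradient_le (h : IsSlice Ω M v G) (hΩo : IsOpen Ω) (hM : 0 ≤ M)
    (ρ : ContDiffBump (0 : E N)) (x : E N) :
    ‖convolution (ρ.normed volume) (Ω.indicator G) (ContinuousLinearMap.lsmul ℝ ℝ) volume x‖
      ≤ M := by
  rw [convolution_eq_swap]
  have hb : ∀ᵐ y, ‖Ω.indicator G y‖ ≤ M := by
    have := (ae_restrict_iff' hΩo.measurableSet).1 h.norm_le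
    filter_upwards [this] with y hy
    by_cases hyΩ : y ∈ Ω
    · simpa [hyΩ] using hy hyΩ
    · simpa [hyΩ] using hM
  have hi : Integrable fun y => ρ.normed volume (x - y) :=
    (ρ.integrable_normed (μ := volume)).comp_sub_left x
  calc ‖∫ y, ContinuousLinearMap.lsmul ℝ ℝ (ρ.normed volume (x - y)) (Ω.indicator G y)‖
      ≤ ∫ y, ρ.normed volume (x - y) * M := by
        refine norm_integral_le_of_norm_le (hi.mul_const M) ?_
        filter_upwards [hb] with y hy
        rw [ContinuousLinearMap.lsmul_apply, norm_smul, Real.norm_of_nonneg (ρ.nonneg_normed _)]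
        exact mul_le_mul_of_nonneg_left hy (ρ.nonneg_normed _)
    _ = M := by
        rw [integral_mul_const, integral_sub_left_eq_self (fun y => ρ.normed volume y) volume x,
          ρ.integral_normed, one_mul]

/-- Chain rule: if the smooth function `θ` vanishes on `(-∞, ε]` with `ε > 0`, then `θ(v)` is in
`H¹₀(Ω)` with gradient `θ'(v) ∇v`. As `v` is below `ε` near the boundary, the functions
`θ(ρₙ ⋆ v)`, with mollifiers `ρₙ` concentrating at the origin, are eventually test functions, and
they approximate `θ(v)`. -/
theorem memH10_comp (h : IsSlice Ω M v G) (hΩo : IsOpen Ω) (hΩb : Bornology.IsBounded Ω)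
    (hM : 0 ≤ M) {θ : ℝ → ℝ} (hθ : ContDiff ℝ ∞ θ) {ε : ℝ} (hε : 0 < ε)
    (hz : ∀ s ≤ ε, θ s = 0) :
    MemH10 Ω (fun x => θ (v x)) (fun x => deriv θ (v x) • G x) := by
  have : IsFiniteMeasure (volume.restrict Ω) := ⟨by simpa using hΩb.measure_lt_top⟩
  have hθc : Continuous θ := hθ.continuous
  have hθd : Continuous (deriv θ) := hθ.continuous_deriv (by simp)
  set V : E N → ℝ := Ω.indicator v with hV
  have hVc : Continuous V := h.continuous_indicator
  have hVs : HasCompactSupport V := hasCompactSupport_indicator hΩb v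
  have hVi : Integrable V := hVc.integrable_of_hasCompactSupport hVs
  have hVb : ∀ x, 0 ≤ V x ∧ V x ≤ M := by
    intro x
    by_cases hx : x ∈ Ω
    · simpa [hV, hx] using ⟨h.nonneg x (subset_closure hx), h.le x (subset_closure hx)⟩
    · simpa [hV, hx] using hM
  let ρ : ℕ → ContDiffBump (0 : E N) := fun n =>
    ⟨1 / ((n : ℝ) + 1), 2 * (1 / ((n : ℝ) + 1)), by positivity, by
      have : 0 < 1 / ((n : ℝ) + 1) := by positivity
      linarith⟩
  have hρ : Tendsto (fun n => (ρ n).rOut) atTop (𝓝 0) := by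
    have := (tendsto_one_div_add_atTop_nhds_zero_nat (𝕜 := ℝ)).const_mul 2
    rwa [mul_zero] at this
  set w : ℕ → E N → ℝ := fun n => convolution ((ρ n).normed volume) V
    (ContinuousLinearMap.lsmul ℝ ℝ) volume with hw
  set H : ℕ → E N → E N := fun n => convolution ((ρ n).normed volume) (Ω.indicator G)
    (ContinuousLinearMap.lsmul ℝ ℝ) volume with hH
  have hws : ∀ n, ContDiff ℝ ∞ (w n) := fun n =>
    (ρ n).hasCompactSupport_normed.contDiff_convolution_left _ (ρ n).contDiff_normed
      hVi.locallyIntegrable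
  have hHs : ∀ n, Continuous (H n) := fun n =>
    ((ρ n).hasCompactSupport_normed.contDiff_convolution_left _
      ((ρ n).contDiff_normed (n := 0))
      (h.integrable_indicator_gradient hΩo hΩb).locallyIntegrable).continuous
  have hunif : ∀ η : ℝ, 0 < η → ∀ᶠ n in atTop, ∀ x, |w n x - V x| ≤ η := by
    intro η hη
    obtain ⟨d, hd, hd'⟩ := Metric.uniformContinuous_iff.1
      (hVs.uniformContinuous_of_continuous hVc) η hη
    filter_upwards [hρ.eventually_lt_const hd] with n hn x
    rw [← Real.dist_eq]
    refine ContDiffBump.dist_normed_convolution_le hVc.aestronglyMeasurable fun y hy => ?_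
    exact (hd' ((Metric.mem_ball.1 hy).trans hn)).le
  have hwlim : ∀ x, Tendsto (fun n => w n x) atTop (𝓝 (V x)) := fun x =>
    ContDiffBump.convolution_tendsto_right_of_continuous hρ hVc x
  have hHlim : ∀ᵐ x ∂(volume.restrict Ω), Tendsto (fun n => H n x) atTop (𝓝 (G x)) := by
    have := ContDiffBump.ae_convolution_tendsto_right_of_locallyIntegrable (μ := volume)
      (K := 2) hρ (Eventually.of_forall fun n => le_rfl)
      (h.integrable_indicator_gradient hΩo hΩb).locallyIntegrable
    rw [ae_restrict_iff' hΩo.measurableSet]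
    filter_upwards [this] with x hx hxΩ
    simpa [hxΩ] using hx
  -- on the compact set `K` the mollification and the gradient commute for large `n`
  set K : Set (E N) := {x | ε / 2 ≤ V x} with hK
  have hKΩ : K ⊆ Ω := by
    intro x hx
    by_contra hxΩ
    have : ε / 2 ≤ V x := hx
    simp [hV, hxΩ] at this
    linarith
  have hKclosed : IsClosed K := isClosed_le continuous_const hVc
  have hKc : IsCompact K :=
    Metric.isCompact_of_isClosed_isBounded hKclosed (hΩb.subset hKΩ)
  obtain ⟨d, hd, hdK⟩ := hKc.exists_cthickening_subset_open hΩo hKΩ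
  have hlarge : ∀ᶠ n in atTop, (ρ n).rOut ≤ d ∧ (∀ x, |w n x - V x| ≤ ε / 4) ∧
      ∀ x, |w n x - V x| ≤ 1 := by
    filter_upwards [hρ.eventually_le_const hd, hunif (ε / 4) (by linarith),
      hunif 1 one_pos] with n h1 h2 h3
    exact ⟨h1, h2, h3⟩
  have hsupp : ∀ n, (∀ x, |w n x - V x| ≤ ε / 4) → ∀ x ∉ K, w n x < ε := by
    intro n hn x hx
    have h1 : V x < ε / 2 := not_le.1 hx
    have h2 := abs_le.1 (hn x)
    linarith
  have htest : ∀ n, (∀ x, |w n x - V x| ≤ ε / 4) → IsTestFunction Ω (fun x => θ (w n x)) := by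
    intro n hn
    have hs : support (fun x => θ (w n x)) ⊆ K := by
      intro x hx
      by_contra hxK
      exact hx (hz _ (hsupp n hn x hxK).le)
    exact ⟨hθ.comp (hws n), HasCompactSupport.of_support_subset_isCompact hKc hs,
      (closure_minimal hs hKclosed).trans hKΩ⟩
  have hdz : ∀ s < ε, deriv θ s = 0 := by
    intro s hs
    have : θ =ᶠ[𝓝 s] fun _ => 0 := by
      filter_upwards [Iio_mem_nhds hs] with y hy using hz y (le_of_lt hy)
    rw [this.deriv_eq]
    simp
  have hgrad : ∀ n, (ρ n).rOut ≤ d → (∀ x, |w n x - V x| ≤ ε / 4) →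
      gradient (fun x => θ (w n x)) = fun x => deriv θ (w n x) • H n x := by
    intro n hnd hn
    ext1 x
    by_cases hx : x ∈ K
    · have hb : Metric.closedBall x (ρ n).rOut ⊆ Ω :=
        (Metric.closedBall_subset_closedBall hnd).trans
          ((Metric.closedBall_subset_cthickening hx d).trans hdK)
      have h1 := h.hasGradientAt_convolution hΩo hΩb (ρ n) hb
      rw [hasGradientAt_iff_hasFDerivAt] at h1
      have h2 : HasDerivAt θ (deriv θ (w n x)) (w n x) :=
        (hθ.differentiable (by simp) _).hasDerivAt
      apply HasGradientAt.gradient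
      rw [hasGradientAt_iff_hasFDerivAt]
      refine (h2.comp_hasFDerivAt x h1).congr_fderiv ?_
      rw [map_smul]
    · have h1 := hsupp n hn x hx
      rw [hdz _ h1, zero_smul]
      have : (fun x => θ (w n x)) =ᶠ[𝓝 x] fun _ => 0 := by
        filter_upwards [(hws n).continuous.continuousAt.preimage_mem_nhds (Iio_mem_nhds h1)]
          with y hy using hz _ (le_of_lt hy)
      rw [this.gradient_eq]
      simp
  -- uniform bounds on the range of `v` and of its mollifications
  obtain ⟨C₀, hC₀⟩ := (isCompact_Icc (a := (-1 : ℝ)) (b := M + 1)).exists_bound_of_continuousOn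
    hθc.continuousOn
  obtain ⟨C₁, hC₁⟩ := (isCompact_Icc (a := (-1 : ℝ)) (b := M + 1)).exists_bound_of_continuousOn
    hθd.continuousOn
  have hC₁0 : 0 ≤ C₁ := (norm_nonneg _).trans (hC₁ 0 ⟨by norm_num, by linarith⟩)
  have hvr : ∀ x ∈ Ω, v x ∈ Icc (-1 : ℝ) (M + 1) := fun x hx =>
    ⟨by linarith [h.nonneg x (subset_closure hx)], by linarith [h.le x (subset_closure hx)]⟩
  have hwr : ∀ n, (∀ x, |w n x - V x| ≤ 1) → ∀ x, w n x ∈ Icc (-1 : ℝ) (M + 1) := by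
    intro n hn x
    have h1 := abs_le.1 (hn x)
    have h2 := hVb x
    exact ⟨by linarith, by linarith⟩
  have hm0 : AEStronglyMeasurable (fun x => θ (v x)) (volume.restrict Ω) :=
    hθc.comp_aestronglyMeasurable h.aestronglyMeasurable
  have hm1 : AEStronglyMeasurable (fun x => deriv θ (v x) • G x) (volume.restrict Ω) :=
    (hθd.comp_aestronglyMeasurable h.aestronglyMeasurable).smul h.aestronglyMeasurable_gradient
  have hb0 : ∀ᵐ x ∂(volume.restrict Ω), ‖θ (v x)‖ ≤ C₀ := by
    filter_upwards [ae_restrict_mem hΩo.measurableSet] with x hx using hC₀ _ (hvr x hx)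
  have hb1 : ∀ᵐ x ∂(volume.restrict Ω), ‖deriv θ (v x) • G x‖ ≤ C₁ * M := by
    filter_upwards [ae_restrict_mem hΩo.measurableSet, h.norm_le] with x hx hGx
    rw [norm_smul]
    exact mul_le_mul (hC₁ _ (hvr x hx)) hGx (norm_nonneg _) hC₁0
  refine ⟨MemLp.of_bound hm0 C₀ hb0, MemLp.of_bound hm1 _ hb1, ?_⟩
  obtain ⟨n₀, hn₀⟩ := eventually_atTop.1 hlarge
  refine ⟨fun n x => θ (w (n + n₀) x), fun n => htest _ (hn₀ _ (Nat.le_add_left _ _)).2.1, ?_, ?_⟩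
  · refine (tendsto_add_atTop_iff_nat (f := fun n =>
      eLpNorm (fun x => θ (w n x) - θ (v x)) 2 (volume.restrict Ω)) n₀).2 ?_
    refine tendsto_eLpNorm_two_of_bounded (C := C₀ + C₀) (fun n =>
      (hθc.comp (hws n).continuous).aestronglyMeasurable) hm0 ?_ ?_
    · filter_upwards [hlarge] with n hn
      filter_upwards [hb0] with x hx
      exact (norm_sub_le _ _).trans (add_le_add (hC₀ _ (hwr n hn.2.2 x)) hx)
    · filter_upwards [ae_restrict_mem hΩo.measurableSet] with x hx
      have h3 : V x = v x := by simp [hV, hx]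
      rw [← h3]
      exact (hθc.tendsto (V x)).comp (hwlim x)
  · have h1 : Tendsto (fun n => eLpNorm (fun x => deriv θ (w n x) • H n x - deriv θ (v x) • G x)
        2 (volume.restrict Ω)) atTop (𝓝 0) := by
      refine tendsto_eLpNorm_two_of_bounded (C := C₁ * M + C₁ * M) (fun n =>
        ((hθd.comp (hws n).continuous).smul (hHs n)).aestronglyMeasurable) hm1 ?_ ?_
      · filter_upwards [hlarge] with n hn
        filter_upwards [hb1] with x hx
        refine (norm_sub_le _ _).trans (add_le_add ?_ hx)
        rw [norm_smul]
        exact mul_le_mul (hC₁ _ (hwr n hn.2.2 x)) (h.norm_convolution_gradient_le hΩo hM _ _)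
          (norm_nonneg _) hC₁0
      · filter_upwards [ae_restrict_mem hΩo.measurableSet, hHlim] with x hx hHx
        have h2 := (hθd.tendsto (V x)).comp (hwlim x)
        have h3 : V x = v x := by simp [hV, hx]
        rw [h3] at h2
        exact h2.smul hHx
    refine ((tendsto_add_atTop_iff_nat n₀).2 h1).congr fun n => ?_
    have h2 := hn₀ (n + n₀) (Nat.le_add_left _ _)
    rw [hgrad _ h2.1 h2.2.1]

end IsSlice

/-! ### Powers of a slice -/

/-- A smooth approximation of `s ↦ s ^ m` that vanishes on `(-∞, ε]`. -/
noncomputable def cutPow (m ε s : ℝ) : ℝ := s ^ m * Real.smoothTransition (s / ε - 1)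

theorem cutPow_eq_zero {m ε s : ℝ} (hε : 0 < ε) (hs : s ≤ ε) : cutPow m ε s = 0 := by
  have : s / ε ≤ 1 := (div_le_one hε).2 hs
  rw [cutPow, Real.smoothTransition.zero_of_nonpos (by linarith), mul_zero]

theorem cutPow_eq_rpow {m ε s : ℝ} (hε : 0 < ε) (hs : 2 * ε ≤ s) : cutPow m ε s = s ^ m := by
  have : 2 ≤ s / ε := (le_div_iff₀ hε).2 hs
  rw [cutPow, Real.smoothTransition.one_of_one_le (by linarith), mul_one]

theorem contDiff_cutPow {m ε : ℝ} (hε : 0 < ε) : ContDiff ℝ ∞ (cutPow m ε) := by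
  rw [contDiff_iff_contDiffAt]
  intro s
  rcases lt_or_ge s ε with hs | hs
  · have : cutPow m ε =ᶠ[𝓝 s] fun _ => 0 := by
      filter_upwards [Iio_mem_nhds hs] with y hy using cutPow_eq_zero hε (le_of_lt hy)
    exact contDiffAt_const.congr_of_eventuallyEq this
  · refine (contDiffAt_id.rpow_const_of_ne (by simp; linarith)).mul ?_
    exact (Real.smoothTransition.contDiff.contDiffAt).comp s (by fun_prop)

/-- The derivative of `cutPow m ε` is dominated by `s ^ (m - 1)` uniformly in `ε`. -/
theorem exists_abs_deriv_cutPow_le {m : ℝ} (hm : 1 < m) : ∃ C : ℝ, ∀ ε s : ℝ, 0 < ε → 0 ≤ s →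
    |deriv (cutPow m ε) s| ≤ C * s ^ (m - 1) := by
  have hc : Continuous (deriv Real.smoothTransition) :=
    (Real.smoothTransition.contDiff (n := 1)).continuous_deriv (by simp)
  obtain ⟨D, hD⟩ := (isCompact_Icc (a := (0 : ℝ)) (b := 1)).exists_bound_of_continuousOn
    hc.continuousOn
  have hD0 : 0 ≤ D := (norm_nonneg _).trans (hD 0 ⟨le_rfl, zero_le_one⟩)
  refine ⟨m + 2 * D, fun ε s hε hs => ?_⟩
  have hs1 : 0 ≤ s ^ (m - 1) := Real.rpow_nonneg hs _
  rcases lt_or_ge s ε with h1 | h1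
  · have : cutPow m ε =ᶠ[𝓝 s] fun _ => 0 := by
      filter_upwards [Iio_mem_nhds h1] with y hy using cutPow_eq_zero hε (le_of_lt hy)
    rw [this.deriv_eq]
    simp only [deriv_const, abs_zero]
    positivity
  have hs0 : 0 < s := hε.trans_le h1
  rcases lt_or_ge (2 * ε) s with h2 | h2
  · have : cutPow m ε =ᶠ[𝓝 s] fun y => y ^ m := by
      filter_upwards [Ioi_mem_nhds h2] with y hy using cutPow_eq_rpow hε (le_of_lt hy)
    rw [this.deriv_eq, (Real.hasDerivAt_rpow_const (Or.inl hs0.ne')).deriv,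
      abs_of_nonneg (by positivity)]
    nlinarith
  · have hT : HasDerivAt (fun y => Real.smoothTransition (y / ε - 1))
        (deriv Real.smoothTransition (s / ε - 1) * (1 / ε)) s := by
      have e1 : HasDerivAt Real.smoothTransition (deriv Real.smoothTransition (s / ε - 1))
          (s / ε - 1) :=
        ((Real.smoothTransition.contDiff (n := 1)).differentiable (by simp) _).hasDerivAt
      exact e1.comp s (((hasDerivAt_id s).div_const ε).sub_const 1)
    have hd := ((Real.hasDerivAt_rpow_const (p := m) (Or.inl hs0.ne')).mul hT).deriv
    have e2 : deriv (cutPow m ε) s = deriv ((fun y => y ^ m) *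
        fun y => Real.smoothTransition (y / ε - 1)) s := rfl
    rw [e2, hd]
    have hr : s / ε - 1 ∈ Icc (0 : ℝ) 1 := by
      constructor
      · linarith [(one_le_div hε).2 h1]
      · linarith [(div_le_iff₀ hε).2 h2]
    have hD1 := hD _ hr
    rw [Real.norm_eq_abs] at hD1
    have hT0 := Real.smoothTransition.nonneg (s / ε - 1)
    have hT1 := Real.smoothTransition.le_one (s / ε - 1)
    have e3 : s ^ m = s ^ (m - 1) * s := by
      rw [← Real.rpow_add_one hs0.ne']; ring_nf
    have e4 : s * (1 / ε) ≤ 2 := by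
      rw [mul_one_div, div_le_iff₀ hε]; linarith
    have e5 : 0 ≤ s * (1 / ε) := by positivity
    calc |m * s ^ (m - 1) * Real.smoothTransition (s / ε - 1)
          + s ^ m * (deriv Real.smoothTransition (s / ε - 1) * (1 / ε))|
        ≤ |m * s ^ (m - 1) * Real.smoothTransition (s / ε - 1)|
          + |s ^ m * (deriv Real.smoothTransition (s / ε - 1) * (1 / ε))| := abs_add_le _ _
      _ = m * s ^ (m - 1) * Real.smoothTransition (s / ε - 1)
          + s ^ (m - 1) * ((s * (1 / ε)) * |deriv Real.smoothTransition (s / ε - 1)|) := by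
          rw [abs_of_nonneg (by positivity), e3, abs_mul, abs_mul, abs_mul,
            abs_of_nonneg hs1, abs_of_pos hs0, abs_of_pos (by positivity : 0 < 1 / ε)]
          ring
      _ ≤ m * s ^ (m - 1) * 1 + s ^ (m - 1) * (2 * D) := by
          gcongr
      _ = (m + 2 * D) * s ^ (m - 1) := by ring

namespace IsSlice

variable {Ω : Set (E N)} {M : ℝ} {v : E N → ℝ} {G : E N → E N}

/-- Powers of a slice belong to `H¹₀(Ω)`, with the expected gradient. -/
theorem memH10_rpow (h : IsSlice Ω M v G) (hΩo : IsOpen Ω) (hΩb : Bornology.IsBounded Ω)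
    (hM : 0 ≤ M) {m : ℝ} (hm : 1 < m) :
    MemH10 Ω (fun x => v x ^ m) (fun x => (m * v x ^ (m - 1)) • G x) := by
  have : IsFiniteMeasure (volume.restrict Ω) := ⟨by simpa using hΩb.measure_lt_top⟩
  obtain ⟨C, hC⟩ := exists_abs_deriv_cutPow_le hm
  have hC0 : 0 ≤ C := by
    have := (abs_nonneg _).trans (hC 1 1 one_pos zero_le_one)
    simpa using this
  set e : ℕ → ℝ := fun n => 1 / ((n : ℝ) + 1) with he
  have he0 : ∀ n, 0 < e n := fun n => by positivity
  have helim : Tendsto e atTop (𝓝 0) := tendsto_one_div_add_atTop_nhds_zero_nat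
  have hmem := fun n => h.memH10_comp hΩo hΩb hM (contDiff_cutPow (m := m) (he0 n)) (he0 n)
    (fun s hs => cutPow_eq_zero (he0 n) hs)
  have hpc : Continuous fun s : ℝ => s ^ m := Real.continuous_rpow_const (by linarith)
  have hpd : Continuous fun s : ℝ => m * s ^ (m - 1) :=
    continuous_const.mul (Real.continuous_rpow_const (by linarith))
  have hm0 : AEStronglyMeasurable (fun x => v x ^ m) (volume.restrict Ω) :=
    hpc.comp_aestronglyMeasurable h.aestronglyMeasurable
  have hm1 : AEStronglyMeasurable (fun x => (m * v x ^ (m - 1)) • G x) (volume.restrict Ω) :=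
    (hpd.comp_aestronglyMeasurable h.aestronglyMeasurable).smul h.aestronglyMeasurable_gradient
  have hv : ∀ᵐ x ∂(volume.restrict Ω), 0 ≤ v x ∧ v x ≤ M := by
    filter_upwards [ae_restrict_mem hΩo.measurableSet] with x hx
    exact ⟨h.nonneg x (subset_closure hx), h.le x (subset_closure hx)⟩
  have hb0 : ∀ᵐ x ∂(volume.restrict Ω), ‖v x ^ m‖ ≤ M ^ m := by
    filter_upwards [hv] with x hx
    rw [Real.norm_of_nonneg (Real.rpow_nonneg hx.1 _)]
    exact Real.rpow_le_rpow hx.1 hx.2 (by linarith)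
  have hb1 : ∀ᵐ x ∂(volume.restrict Ω), ‖(m * v x ^ (m - 1)) • G x‖ ≤ m * M ^ (m - 1) * M := by
    filter_upwards [hv, h.norm_le] with x hx hGx
    have h1 := Real.rpow_nonneg hx.1 (m - 1)
    rw [norm_smul, Real.norm_of_nonneg (by positivity)]
    have := Real.rpow_le_rpow hx.1 hx.2 (by linarith : 0 ≤ m - 1)
    gcongr
  refine MemH10.of_tendsto hmem (MemLp.of_bound hm0 _ hb0) (MemLp.of_bound hm1 _ hb1) ?_ ?_
  · refine tendsto_eLpNorm_two_of_bounded (C := M ^ m + M ^ m) (fun n => (hmem n).1.1) hm0 ?_ ?_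
    · refine Eventually.of_forall fun n => ?_
      filter_upwards [hb0, hv] with x hx hvx
      refine (norm_sub_le _ _).trans (add_le_add ?_ hx)
      rw [cutPow, norm_mul, Real.norm_of_nonneg (Real.smoothTransition.nonneg _)]
      calc ‖v x ^ m‖ * _ ≤ M ^ m * 1 :=
            mul_le_mul hx (Real.smoothTransition.le_one _) (Real.smoothTransition.nonneg _)
              (Real.rpow_nonneg hM _)
        _ = M ^ m := mul_one _
    · filter_upwards [hv] with x hvx
      rcases hvx.1.eq_or_lt with h0 | h0
      · simp [← h0, cutPow, Real.zero_rpow (by positivity : m ≠ 0)]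
      · refine tendsto_const_nhds.congr' ?_
        have : ∀ᶠ n in atTop, e n < v x / 2 := helim.eventually_lt_const (by linarith)
        filter_upwards [this] with n hn
        rw [cutPow_eq_rpow (he0 n) (by linarith)]
  · refine tendsto_eLpNorm_two_of_bounded (C := C * M ^ (m - 1) * M + m * M ^ (m - 1) * M)
      (fun n => (hmem n).2.1.1) hm1 ?_ ?_
    · refine Eventually.of_forall fun n => ?_
      filter_upwards [hb1, hv, h.norm_le] with x hx hvx hGx
      refine (norm_sub_le _ _).trans (add_le_add ?_ hx)
      rw [norm_smul, Real.norm_eq_abs]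
      have h1 := hC (e n) (v x) (he0 n) hvx.1
      have h2 := Real.rpow_le_rpow hvx.1 hvx.2 (by linarith : 0 ≤ m - 1)
      refine mul_le_mul (h1.trans ?_) hGx (norm_nonneg _) ?_
      · gcongr
      · have := Real.rpow_nonneg hM (m - 1)
        positivity
    · filter_upwards [hv] with x hvx
      rcases hvx.1.eq_or_lt with h0 | h0
      · have hz : ∀ n, deriv (cutPow m (e n)) (v x) = 0 := by
          intro n
          have := hC (e n) (v x) (he0 n) hvx.1
          rw [← h0, Real.zero_rpow (by linarith), mul_zero] at this
          rw [← h0]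
          exact abs_nonpos_iff.1 this
        simp only [hz]
        rw [← h0, Real.zero_rpow (by linarith)]
        simp
      · refine tendsto_const_nhds.congr' ?_
        have : ∀ᶠ n in atTop, e n < v x / 2 := helim.eventually_lt_const (by linarith)
        filter_upwards [this] with n hn
        have h1 : cutPow m (e n) =ᶠ[𝓝 (v x)] fun y => y ^ m := by
          filter_upwards [Ioi_mem_nhds (show 2 * e n < v x by linarith)] with y hy
            using cutPow_eq_rpow (he0 n) (le_of_lt hy)
        rw [h1.deriv_eq, (Real.hasDerivAt_rpow_const (Or.inl h0.ne')).deriv]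

end IsSlice

/-! ### The weighted Poincaré inequality -/

/-- Convergence in `L²` on a finite measure space implies convergence of integrals. -/
theorem tendsto_integral_of_tendsto_eLpNorm_two {α : Type*} [MeasurableSpace α] {μ : Measure α}
    [IsFiniteMeasure μ] {f : ℕ → α → ℝ} {g : α → ℝ} (hf : ∀ n, MemLp (f n) 2 μ)
    (hg : MemLp g 2 μ) (h : Tendsto (fun n => eLpNorm (fun x => f n x - g x) 2 μ) atTop (𝓝 0)) :
    Tendsto (fun n => ∫ x, f n x ∂μ) atTop (𝓝 (∫ x, g x ∂μ)) := by
  refine tendsto_integral_of_L1' g hg.1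
    (Eventually.of_forall fun n => (hf n).integrable (by norm_num)) ?_
  have h1 := ENNReal.Tendsto.mul_const (b := μ univ ^ (1 / (1 : ENNReal).toReal
    - 1 / (2 : ENNReal).toReal)) h (Or.inr
    (ENNReal.rpow_ne_top_of_nonneg (by norm_num) (measure_ne_top _ _)))
  rw [zero_mul] at h1
  refine tendsto_of_tendsto_of_tendsto_of_le_of_le tendsto_const_nhds h1 (fun _ => zero_le)
    fun n => ?_
  exact eLpNorm_le_eLpNorm_mul_rpow_measure_univ (by norm_num) ((hf n).1.sub hg.1)

/-- Integration by parts against a coordinate function, for compactly supported functions. -/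
theorem IsTestFunction.integral_eq_neg_integral_coord_mul {Ω : Set (E N)} {φ : E N → ℝ}
    (hφ : IsTestFunction Ω φ) (i : Fin N) :
    ∫ x in Ω, φ x = -∫ x in Ω, x i * (gradient φ x) i := by
  have hz : ∀ x ∉ Ω, φ x = 0 := fun x hx =>
    image_eq_zero_of_notMem_tsupport fun h => hx (hφ.2.2 h)
  have hg : ∀ x, (gradient φ x) i = fderiv ℝ φ x (EuclideanSpace.single i (1 : ℝ)) := by
    intro x
    rw [← inner_gradient_left, EuclideanSpace.inner_single_right]
    simp
  have hz' : ∀ x ∉ Ω, x i * (gradient φ x) i = 0 := by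
    intro x hx
    have : x ∉ tsupport (fderiv ℝ φ) := fun h => hx (hφ.2.2 (tsupport_fderiv_subset ℝ h))
    rw [hg, image_eq_zero_of_notMem_tsupport this]
    simp
  rw [setIntegral_eq_integral_of_forall_compl_eq_zero hz,
    setIntegral_eq_integral_of_forall_compl_eq_zero hz']
  simp only [hg]
  let c : E N →L[ℝ] ℝ := EuclideanSpace.proj i
  have hd : Continuous (fderiv ℝ φ) := hφ.1.continuous_fderiv (by simp)
  have hc : ∀ x, fderiv ℝ (fun x : E N => x i) x (EuclideanSpace.single i (1 : ℝ)) = 1 := by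
    intro x
    have : (fun x : E N => x i) = c := rfl
    rw [this, c.fderiv]
    simp [c]
  rw [integral_mul_fderiv_eq_neg_fderiv_mul_of_integrable (f := fun x : E N => x i) (g := φ)]
  · simp [hc]
  · simp only [hc, one_mul]
    exact hφ.1.continuous.integrable_of_hasCompactSupport hφ.2.1
  · refine Continuous.integrable_of_hasCompactSupport ?_ ?_
    · exact c.continuous.mul (hd.clm_apply continuous_const)
    · exact ((hφ.2.1.fderiv_apply (𝕜 := ℝ) _)).mul_left
  · exact (c.continuous.mul hφ.1.continuous).integrable_of_hasCompactSupport hφ.2.1.mul_left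
  · exact fun x _ => c.differentiableAt
  · exact fun x _ => hφ.1.differentiable (by simp) x

theorem ae_norm_coord_mul_le {Ω : Set (E N)} (hΩo : IsOpen Ω) {R : ℝ} (hR : ∀ x ∈ Ω, ‖x‖ ≤ R)
    (i : Fin N) (F : E N → E N) :
    ∀ᵐ x ∂(volume.restrict Ω), ‖x i * (F x) i‖ ≤ R * ‖F x‖ := by
  filter_upwards [ae_restrict_mem hΩo.measurableSet] with x hx
  rw [norm_mul]
  exact mul_le_mul ((PiLp.norm_apply_le x i).trans (hR x hx)) (PiLp.norm_apply_le _ i)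
    (norm_nonneg _) ((norm_nonneg _).trans (hR x hx))

theorem memLp_coord_mul {Ω : Set (E N)} (hΩo : IsOpen Ω) {R : ℝ} (hR : ∀ x ∈ Ω, ‖x‖ ≤ R)
    (i : Fin N) {F : E N → E N} (hF : MemLp F 2 (volume.restrict Ω)) :
    MemLp (fun x => x i * (F x) i) 2 (volume.restrict Ω) := by
  have hci : Continuous fun x : E N => x i := (EuclideanSpace.proj (𝕜 := ℝ) i).continuous
  exact hF.of_le_mul (hci.aestronglyMeasurable.mul (hci.comp_aestronglyMeasurable hF.1))
    (ae_norm_coord_mul_le hΩo hR i F)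

theorem MemH10.integral_eq_neg_integral_coord_mul {Ω : Set (E N)} {ψ : E N → ℝ}
    {Dψ : E N → E N} (h : MemH10 Ω ψ Dψ) (hΩo : IsOpen Ω) {R : ℝ} (hR : ∀ x ∈ Ω, ‖x‖ ≤ R)
    (i : Fin N) : ∫ x in Ω, ψ x = -∫ x in Ω, x i * (Dψ x) i := by
  have hΩb : Bornology.IsBounded Ω := isBounded_iff_forall_norm_le.2 ⟨R, hR⟩
  have : IsFiniteMeasure (volume.restrict Ω) := ⟨by simpa using hΩb.measure_lt_top⟩
  obtain ⟨h0, h1, φ, hφ, l0, l1⟩ := h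
  have hφm : ∀ n, MemLp (φ n) 2 (volume.restrict Ω) := fun n =>
    ((hφ n).1.continuous.memLp_of_hasCompactSupport (hφ n).2.1).restrict Ω
  have hgm : ∀ n, MemLp (gradient (φ n)) 2 (volume.restrict Ω) := by
    intro n
    have hs : HasCompactSupport (gradient (φ n)) :=
      (hφ n).2.1.fderiv (𝕜 := ℝ) |>.comp_left (map_zero _)
    exact ((hφ n).continuous_gradient.memLp_of_hasCompactSupport hs).restrict Ω
  have t0 := tendsto_integral_of_tendsto_eLpNorm_two hφm h0 l0
  have t1 : Tendsto (fun n => ∫ x in Ω, x i * (gradient (φ n) x) i) atTop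
      (𝓝 (∫ x in Ω, x i * (Dψ x) i)) := by
    refine tendsto_integral_of_tendsto_eLpNorm_two
      (fun n => memLp_coord_mul hΩo hR i (hgm n)) (memLp_coord_mul hΩo hR i h1) ?_
    have h2 := ENNReal.Tendsto.const_mul (a := ENNReal.ofReal R) l1 (Or.inr (by finiteness))
    rw [mul_zero] at h2
    refine tendsto_of_tendsto_of_tendsto_of_le_of_le tendsto_const_nhds h2 (fun _ => zero_le)
      fun n => ?_
    refine eLpNorm_le_mul_eLpNorm_of_ae_le_mul ?_ 2
    filter_upwards [ae_norm_coord_mul_le hΩo hR i (fun x => gradient (φ n) x - Dψ x)] with x hx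
    rw [PiLp.sub_apply, mul_sub] at hx
    exact hx
  refine tendsto_nhds_unique t0 ?_
  simp only [(hφ _).integral_eq_neg_integral_coord_mul i]
  exact t1.neg

namespace IsSlice

variable {Ω : Set (E N)} {M : ℝ} {v : E N → ℝ} {G : E N → E N}

theorem ae_bounds (h : IsSlice Ω M v G) (hΩo : IsOpen Ω) :
    ∀ᵐ x ∂(volume.restrict Ω), 0 ≤ v x ∧ v x ≤ M ∧ ‖G x‖ ≤ M := by
  filter_upwards [ae_restrict_mem hΩo.measurableSet, h.norm_le] with x hx hG
  exact ⟨h.nonneg x (subset_closure hx), h.le x (subset_closure hx), hG⟩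

theorem integrable_rpow_mul (h : IsSlice Ω M v G) (hΩo : IsOpen Ω)
    (hΩb : Bornology.IsBounded Ω) {a b : ℝ} (ha : 0 ≤ a) (hb : 0 ≤ b) :
    IntegrableOn (fun x => v x ^ a * ‖G x‖ ^ b) Ω := by
  have : IsFiniteMeasure (volume.restrict Ω) := ⟨by simpa using hΩb.measure_lt_top⟩
  refine Integrable.of_bound (C := M ^ a * M ^ b) ?_ ?_
  · exact ((Real.continuous_rpow_const ha).comp_aestronglyMeasurable h.aestronglyMeasurable).mul
      ((Real.continuous_rpow_const hb).comp_aestronglyMeasurable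
        h.aestronglyMeasurable_gradient.norm)
  · filter_upwards [h.ae_bounds hΩo] with x ⟨h0, h1, h2⟩
    rw [norm_mul, Real.norm_of_nonneg (Real.rpow_nonneg h0 _),
      Real.norm_of_nonneg (Real.rpow_nonneg (norm_nonneg _) _)]
    exact mul_le_mul (Real.rpow_le_rpow h0 h1 ha) (Real.rpow_le_rpow (norm_nonneg _) h2 hb)
      (Real.rpow_nonneg (norm_nonneg _) _) (Real.rpow_nonneg (h0.trans h1) _)

theorem integrable_rpow (h : IsSlice Ω M v G) (hΩo : IsOpen Ω)
    (hΩb : Bornology.IsBounded Ω) {a : ℝ} (ha : 0 ≤ a) :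
    IntegrableOn (fun x => v x ^ a) Ω := by
  simpa using h.integrable_rpow_mul hΩo hΩb ha le_rfl

/-- Weighted Poincaré inequality. The constant comes from integrating `v ^ m` by parts against a
coordinate function and absorbing half of the result. -/
theorem integral_rpow_le (h : IsSlice Ω M v G) (hN : 1 ≤ N) (hΩo : IsOpen Ω) (hM : 0 ≤ M)
    {R : ℝ} (hR0 : 0 < R) (hR : ∀ x ∈ Ω, ‖x‖ ≤ R) {m q : ℝ} (hq : 1 < q) (hm : q < m) :
    ∫ x in Ω, v x ^ m ≤ 2 * (2 * R * m) ^ q * ∫ x in Ω, v x ^ (m - q) * ‖G x‖ ^ q := by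
  have hΩb : Bornology.IsBounded Ω := isBounded_iff_forall_norm_le.2 ⟨R, hR⟩
  have hm0 : 0 < m := by linarith
  let i : Fin N := ⟨0, hN⟩
  have : IsFiniteMeasure (volume.restrict Ω) := ⟨by simpa using hΩb.measure_lt_top⟩
  have hmem := h.memH10_rpow hΩo hΩb hM (hq.trans hm)
  have e1 := hmem.integral_eq_neg_integral_coord_mul hΩo hR i
  have key : ∀ᵐ x ∂(volume.restrict Ω), -(x i * ((m * v x ^ (m - 1)) • G x) i)
      ≤ 1 / 2 * v x ^ m + (2 * R * m) ^ q * (v x ^ (m - q) * ‖G x‖ ^ q) := by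
    filter_upwards [ae_restrict_mem hΩo.measurableSet, h.ae_bounds hΩo] with x hx hb
    have h0 := hb.1
    have hp1 := Real.rpow_nonneg h0 (m - 1)
    have hp2 := Real.rpow_nonneg h0 (m - q)
    have a1 : -(x i * ((m * v x ^ (m - 1)) • G x) i) ≤ R * m * v x ^ (m - 1) * ‖G x‖ := by
      refine (neg_le_abs _).trans ?_
      have b0 : 0 ≤ m * v x ^ (m - 1) := by positivity
      rw [PiLp.smul_apply, smul_eq_mul, abs_mul, abs_mul, abs_of_nonneg b0]
      have b1 : |x i| ≤ R := (PiLp.norm_apply_le x i).trans (hR x hx)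
      have b2 : |G x i| ≤ ‖G x‖ := PiLp.norm_apply_le (G x) i
      calc |x i| * (m * v x ^ (m - 1) * |G x i|) ≤ R * (m * v x ^ (m - 1) * ‖G x‖) := by gcongr
        _ = R * m * v x ^ (m - 1) * ‖G x‖ := by ring
    refine a1.trans ?_
    rcases h0.eq_or_lt with hv | hv
    · rw [← hv, Real.zero_rpow (by linarith), Real.zero_rpow (by linarith),
        Real.zero_rpow (by linarith)]
      simp
    have hpm := Real.rpow_nonneg h0 m
    rcases le_total (2 * R * m * ‖G x‖) (v x) with hc | hc
    · have b1 : v x ^ m = v x ^ (m - 1) * v x := by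
        rw [← Real.rpow_add_one hv.ne']; ring_nf
      have b2 : 0 ≤ (2 * R * m) ^ q * (v x ^ (m - q) * ‖G x‖ ^ q) := by positivity
      rw [b1]
      nlinarith
    · have b1 : v x ^ (m - 1) = v x ^ (m - q) * v x ^ (q - 1) := by
        rw [← Real.rpow_add hv]; ring_nf
      have hz : 0 < 2 * R * m * ‖G x‖ := hv.trans_le hc
      have b2 : v x ^ (q - 1) ≤ (2 * R * m * ‖G x‖) ^ (q - 1) :=
        Real.rpow_le_rpow h0 hc (by linarith)
      have b3 : (2 * R * m) ^ q * ‖G x‖ ^ q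
          = (2 * R * m * ‖G x‖) ^ (q - 1) * (2 * R * m * ‖G x‖) := by
        rw [← Real.mul_rpow (by positivity) (norm_nonneg _), ← Real.rpow_add_one hz.ne']
        ring_nf
      calc R * m * v x ^ (m - 1) * ‖G x‖
          = 1 / 2 * (v x ^ (m - q) * (v x ^ (q - 1) * (2 * R * m * ‖G x‖))) := by
            rw [b1]; ring
        _ ≤ 1 * (v x ^ (m - q) * ((2 * R * m * ‖G x‖) ^ (q - 1) * (2 * R * m * ‖G x‖))) := by
            gcongr
            norm_num
        _ = (2 * R * m) ^ q * (v x ^ (m - q) * ‖G x‖ ^ q) := by rw [← b3]; ring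
        _ ≤ _ := by linarith
  have i1 := h.integrable_rpow hΩo hΩb hm0.le
  have i2 := h.integrable_rpow_mul hΩo hΩb (a := m - q) (b := q) (by linarith) (by linarith)
  have i3 := (i1.const_mul (1 / 2)).add (i2.const_mul ((2 * R * m) ^ q))
  have e2 : ∫ x in Ω, v x ^ m ≤
      ∫ x in Ω, (1 / 2 * v x ^ m + (2 * R * m) ^ q * (v x ^ (m - q) * ‖G x‖ ^ q)) := by
    rw [e1, ← integral_neg]
    exact integral_mono_ae ((memLp_coord_mul hΩo hR i hmem.2.1).integrable (by norm_num)).neg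
      i3 key
  rw [integral_add (i1.const_mul _) (i2.const_mul _), integral_const_mul, integral_const_mul] at e2
  linarith

end IsSlice

/-! ### Absorption of the diffusion term -/

/-- Young's inequality for the diffusion term, with `r = q / (q - p)`. -/
theorem mul_rpow_mul_rpow_le {p q r w α : ℝ} (hp : 0 < p) (hpq : p < q) (hr : r = q / (q - p))
    (hw : 0 ≤ w) (hα : 0 ≤ α) :
    r * (w ^ (r - 1) * α ^ p) ≤ 1 / 4 * (α ^ q * w ^ r) + r * (4 * r) ^ (r - 1) := by
  have hqp : 0 < q - p := by linarith
  have hr1 : r - 1 = p / (q - p) := by rw [hr]; field_simp; ring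
  have hr1' : 0 < r - 1 := by rw [hr1]; positivity
  have hr0 : 0 < r := by linarith
  have hp1 := Real.rpow_nonneg hw (r - 1)
  have hp2 := Real.rpow_nonneg hα p
  rcases hw.eq_or_lt with h | hw0
  · rw [← h, Real.zero_rpow hr1'.ne', Real.zero_rpow hr0.ne']
    simp only [zero_mul, mul_zero, zero_add]
    positivity
  rcases hα.eq_or_lt with h | hα0
  · rw [← h, Real.zero_rpow hp.ne', Real.zero_rpow (by linarith)]
    simp only [zero_mul, mul_zero, zero_add]
    positivity
  have e1 : α ^ q * w ^ r = (w * α ^ (q - p)) * (w ^ (r - 1) * α ^ p) := by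
    have a1 : α ^ q = α ^ (q - p) * α ^ p := by rw [← Real.rpow_add hα0]; ring_nf
    have a2 : w ^ r = w ^ (r - 1) * w := by rw [← Real.rpow_add_one hw0.ne']; ring_nf
    rw [a1, a2]; ring
  have e2 : w ^ (r - 1) * α ^ p = (w * α ^ (q - p)) ^ (r - 1) := by
    rw [Real.mul_rpow hw (by positivity), ← Real.rpow_mul hα, hr1]
    congr 2
    field_simp
  have e3 : 0 ≤ r * (4 * r) ^ (r - 1) := by positivity
  rcases le_total (4 * r) (w * α ^ (q - p)) with hc | hc
  · have : 4 * r * (w ^ (r - 1) * α ^ p) ≤ α ^ q * w ^ r := by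
      rw [e1]; gcongr
    linarith
  · have a1 : w ^ (r - 1) * α ^ p ≤ (4 * r) ^ (r - 1) := by
      rw [e2]
      exact Real.rpow_le_rpow (by positivity) hc hr1'.le
    have a2 : 0 ≤ α ^ q * w ^ r := by positivity
    nlinarith

/-- Lower bound for the integrand of the weak formulation, for the gradients `A` and `B` of the
solution at two different times and for the test function `w ^ r`, with `w` the solution at the
second time. -/
theorem weak_integrand_lower_bound {p q r w : ℝ} (hp : 2 ≤ p) (hpq : p < q)
    (hr : r = q / (q - p)) (hw : 0 ≤ w) (A B : E N) :
    3 / 4 * (w ^ r * ‖A‖ ^ q) - 1 / 4 * (w ^ r * ‖B‖ ^ q) - 2 * (r * (4 * r) ^ (r - 1))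
      ≤ -(‖A‖ ^ (p - 2) * inner ℝ A ((r * w ^ (r - 1)) • B)) + ‖A‖ ^ q * w ^ r := by
  have hqp : 0 < q - p := by linarith
  have hr0 : 0 < r := by rw [hr]; exact div_pos (by linarith) hqp
  have hp1 := Real.rpow_nonneg hw (r - 1)
  have y1 := mul_rpow_mul_rpow_le (α := ‖A‖) (by linarith) hpq hr hw (norm_nonneg _)
  have y2 := mul_rpow_mul_rpow_le (α := ‖B‖) (by linarith) hpq hr hw (norm_nonneg _)
  have a1 : ‖A‖ ^ (p - 2) * (‖A‖ * ‖B‖) ≤ ‖A‖ ^ p + ‖B‖ ^ p := by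
    have c1 : ∀ t : ℝ, 0 ≤ t → t ^ (p - 2) * (t * t) = t ^ p := by
      intro t ht
      have : p = (p - 2) + 2 := by ring
      conv_rhs => rw [this, Real.rpow_add' ht (by linarith)]
      norm_cast
      rw [pow_two]
    have c2 := Real.rpow_nonneg (norm_nonneg A) p
    have c3 := Real.rpow_nonneg (norm_nonneg B) p
    rcases le_total ‖A‖ ‖B‖ with hc | hc
    · calc ‖A‖ ^ (p - 2) * (‖A‖ * ‖B‖) ≤ ‖B‖ ^ (p - 2) * (‖B‖ * ‖B‖) := by
            have := Real.rpow_le_rpow (norm_nonneg _) hc (by linarith : 0 ≤ p - 2)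
            gcongr
        _ = ‖B‖ ^ p := c1 _ (norm_nonneg _)
        _ ≤ _ := by linarith
    · calc ‖A‖ ^ (p - 2) * (‖A‖ * ‖B‖) ≤ ‖A‖ ^ (p - 2) * (‖A‖ * ‖A‖) := by
            gcongr
        _ = ‖A‖ ^ p := c1 _ (norm_nonneg _)
        _ ≤ _ := by linarith
  have a2 : ‖A‖ ^ (p - 2) * inner ℝ A ((r * w ^ (r - 1)) • B)
      ≤ r * (w ^ (r - 1) * ‖A‖ ^ p) + r * (w ^ (r - 1) * ‖B‖ ^ p) := by
    rw [inner_smul_right]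
    have b1 : ‖A‖ ^ (p - 2) * inner ℝ A B ≤ ‖A‖ ^ p + ‖B‖ ^ p :=
      (mul_le_mul_of_nonneg_left (real_inner_le_norm A B)
        (Real.rpow_nonneg (norm_nonneg _) _)).trans a1
    calc _ = (r * w ^ (r - 1)) * (‖A‖ ^ (p - 2) * inner ℝ A B) := by ring
      _ ≤ (r * w ^ (r - 1)) * (‖A‖ ^ p + ‖B‖ ^ p) := by gcongr
      _ = _ := by ring
  linarith [mul_comm (w ^ r) (‖A‖ ^ q), mul_comm (w ^ r) (‖B‖ ^ q)]

/-! ### Integrated difference inequalities -/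

/-- A difference inequality `f (t + h) - f t ≥ -h (B t + δ)`, valid for almost every `t` once `h` is
small, integrates to `f b - f a ≥ -∫ B`. No differentiability of `f` is needed, because the
averages `h⁻¹ ∫ (f (t + h) - f t) dt` converge to `f b - f a` for continuous `f`. -/
theorem neg_integral_le_sub_of_ae_difference {f B : ℝ → ℝ} {a b : ℝ} (hab : a ≤ b)
    (hf : Continuous f) (hB : IntervalIntegrable B volume a b)
    (H : ∀ δ > 0, ∀ᶠ h in 𝓝[>] (0 : ℝ), ∀ᵐ t, t ∈ Ioc a b →
      -(h * (B t + δ)) ≤ f (t + h) - f t) :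
    -(∫ t in a..b, B t) ≤ f b - f a := by
  have hfi : ∀ x y, IntervalIntegrable f volume x y := fun x y => hf.intervalIntegrable x y
  set F : ℝ → ℝ := fun x => ∫ t in (0 : ℝ)..x, f t with hF
  have hFd : ∀ x, Tendsto (fun h => h⁻¹ • (F (x + h) - F x)) (𝓝[>] 0) (𝓝 (f x)) := fun x =>
    (intervalIntegral.integral_hasDerivAt_right (hfi 0 x)
      (hf.stronglyMeasurableAtFilter _ _) hf.continuousAt).tendsto_slope_zero_right
  have hlim := (hFd b).sub (hFd a)
  refine le_of_forall_pos_le_add fun ε hε => ?_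
  set δ := ε / (b - a + 1) with hδ
  have hδ0 : 0 < δ := div_pos hε (by linarith)
  have hδε : δ * (b - a) ≤ ε := by
    rw [hδ, div_mul_eq_mul_div, div_le_iff₀ (by linarith)]
    nlinarith
  refine le_trans ?_ (add_le_add_left (ge_of_tendsto (b := -(∫ t in a..b, B t) - ε) hlim ?_) ε)
  · linarith
  filter_upwards [H δ hδ0, self_mem_nhdsWithin] with h hh hh0
  have hh0 : 0 < h := hh0
  have i1 : IntervalIntegrable (fun t => f (t + h)) volume a b :=
    (hf.comp (by fun_prop)).intervalIntegrable a b
  have e1 : ∫ t in a..b, -(h * (B t + δ)) ≤ ∫ t in a..b, (f (t + h) - f t) := by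
    rw [intervalIntegral.integral_of_le hab, intervalIntegral.integral_of_le hab]
    exact setIntegral_mono_on_ae (((hB.add intervalIntegrable_const).const_mul h).neg).1
      (i1.sub (hfi a b)).1 measurableSet_Ioc hh
  have e2 : ∫ t in a..b, (f (t + h) - f t) = (F (b + h) - F b) - (F (a + h) - F a) := by
    rw [intervalIntegral.integral_sub i1 (hfi a b), intervalIntegral.integral_comp_add_right]
    have c1 : ∀ x y, ∫ t in x..y, f t = F y - F x := fun x y =>
      (intervalIntegral.integral_interval_sub_left (hfi 0 y) (hfi 0 x)).symm
    rw [c1, c1]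
    ring
  have e3 : ∫ t in a..b, -(h * (B t + δ)) = h * (-(∫ t in a..b, B t) - δ * (b - a)) := by
    rw [intervalIntegral.integral_neg, intervalIntegral.integral_const_mul,
      intervalIntegral.integral_add hB intervalIntegrable_const, intervalIntegral.integral_const,
      smul_eq_mul]
    ring
  rw [e2, e3] at e1
  rw [smul_eq_mul, smul_eq_mul, ← mul_sub]
  rw [← div_eq_inv_mul, le_div_iff₀ hh0]
  nlinarith

theorem integral_le_sub_of_ae_difference {Y B : ℝ → ℝ} {a b K : ℝ} (hab : a ≤ b)
    (hY : Continuous Y) (hB : Integrable B)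
    (H : ∀ δ > 0, ∀ᶠ h in 𝓝[>] (0 : ℝ), ∀ᵐ t, t ∈ Ioc a b →
      3 / 4 * (∫ s in t..t + h, B s) - h * (1 / 4 * B t + K + δ) ≤ Y (t + h) - Y t) :
    1 / 2 * (∫ t in a..b, B t) - K * (b - a) ≤ Y b - Y a := by
  have hBi : ∀ x y, IntervalIntegrable B volume x y := fun x y => hB.intervalIntegrable
  have hP : Continuous fun x => ∫ t in (0 : ℝ)..x, B t :=
    intervalIntegral.continuous_primitive hBi 0
  have c1 : ∀ x y, ∫ t in x..y, B t = (∫ t in (0 : ℝ)..y, B t) - ∫ t in (0 : ℝ)..x, B t :=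
    fun x y => (intervalIntegral.integral_interval_sub_left (hBi 0 y) (hBi 0 x)).symm
  have h1 := neg_integral_le_sub_of_ae_difference
    (f := fun x => Y x - 3 / 4 * ∫ t in (0 : ℝ)..x, B t) (B := fun t => 1 / 4 * B t + K) hab
    (hY.sub (hP.const_mul _)) (((hBi a b).const_mul _).add intervalIntegrable_const) ?_
  · rw [intervalIntegral.integral_add ((hBi a b).const_mul _) intervalIntegrable_const,
      intervalIntegral.integral_const_mul, intervalIntegral.integral_const, smul_eq_mul] at h1
    have := c1 a b
    linarith
  · intro δ hδ
    filter_upwards [H δ hδ] with h hh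
    filter_upwards [hh] with t ht hmem
    have h2 := ht hmem
    rw [c1] at h2
    linarith

/-! ### Finite-time blow-up -/

section Blowup

variable {Y : ℝ → ℝ} {γ c K A₀ : ℝ}

/-- A continuous function satisfying the integrated form of `Y' ≥ c Y ^ γ - K` grows at least
linearly once it exceeds the threshold at which the source beats `K`. -/
theorem linear_growth (hY : Continuous Y) (hγ : 0 < γ) (hc : 0 < c)
    (H : ∀ a b A, 0 ≤ a → a ≤ b → 0 ≤ A → (∀ t ∈ Icc a b, A ≤ Y t) →
      (b - a) * (c * A ^ γ - K) ≤ Y b - Y a)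
    (hA₀ : 0 < A₀) (hK : K ≤ c / 2 * (A₀ / 2) ^ γ) {a A : ℝ} (ha : 0 ≤ a) (hA : A₀ ≤ A)
    (hYa : A ≤ Y a) {b : ℝ} (hab : a ≤ b) :
    Y a + (b - a) * (c / 2 * (A / 2) ^ γ) ≤ Y b := by
  have hmono : (A₀ / 2) ^ γ ≤ (A / 2) ^ γ := by gcongr
  have hKA : c / 2 * (A / 2) ^ γ ≤ c * (A / 2) ^ γ - K := by nlinarith
  have hpos : 0 ≤ c / 2 * (A / 2) ^ γ := by
    have := Real.rpow_nonneg (by linarith : 0 ≤ A / 2) γ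
    positivity
  have step : ∀ s, a ≤ s → (∀ t ∈ Icc a s, A / 2 ≤ Y t) →
      Y a + (s - a) * (c / 2 * (A / 2) ^ γ) ≤ Y s := by
    intro s hs hbd
    have h1 := H a s (A / 2) ha hs (by linarith) hbd
    have h2 := mul_le_mul_of_nonneg_left hKA (sub_nonneg.2 hs)
    linarith
  refine step b hab ?_
  by_contra! hcon
  obtain ⟨t₀, ht₀, hlt⟩ := hcon
  -- the first time at which `Y` falls to `A / 2`
  have hS : IsCompact (Icc a b ∩ {t | Y t ≤ A / 2}) :=
    isCompact_Icc.inter_right (isClosed_le hY continuous_const)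
  obtain ⟨s, ⟨hs, hYs⟩, hleast⟩ := hS.exists_isLeast ⟨t₀, ht₀, hlt.le⟩
  have hYs : Y s ≤ A / 2 := hYs
  have has : a < s := by
    rcases hs.1.eq_or_lt with h | h
    · rw [← h] at hYs; linarith
    · exact h
  have hIco : ∀ t ∈ Ico a s, A / 2 ≤ Y t := by
    intro t ht
    by_contra! h
    exact absurd (hleast ⟨⟨ht.1, ht.2.le.trans hs.2⟩, h.le⟩) (not_le.2 ht.2)
  have hIcc : ∀ t ∈ Icc a s, A / 2 ≤ Y t := by
    have := closure_minimal hIco (isClosed_le continuous_const hY)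
    rwa [closure_Ico has.ne] at this
  have := step s has.le hIcc
  have h2 : 0 ≤ (s - a) * (c / 2 * (A / 2) ^ γ) := mul_nonneg (by linarith) hpos
  linarith

/-- Finite-time blow-up for `Y' ≥ c Y ^ γ - K` with `γ > 1`: the times needed for successive
doublings of `Y` form a convergent geometric series. -/
theorem blowup (hY : Continuous Y) (hγ : 1 < γ) (hc : 0 < c)
    (H : ∀ a b A, 0 ≤ a → a ≤ b → 0 ≤ A → (∀ t ∈ Icc a b, A ≤ Y t) →
      (b - a) * (c * A ^ γ - K) ≤ Y b - Y a)
    (hA₀ : 0 < A₀) (hK : K ≤ c / 2 * (A₀ / 2) ^ γ) : Y 0 < A₀ := by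
  by_contra! hY0
  set ρ : ℝ := 2 / 2 ^ γ with hρ
  have h2γ : (2 : ℝ) < 2 ^ γ := by
    simpa using Real.rpow_lt_rpow_of_exponent_lt (one_lt_two) hγ
  have hρ0 : 0 < ρ := by positivity
  have hρ1 : ρ < 1 := (div_lt_one (by positivity)).2 h2γ
  have hAp : 0 < (A₀ / 2) ^ γ := Real.rpow_pos_of_pos (by linarith) _
  set τ : ℝ := A₀ / (c / 2 * (A₀ / 2) ^ γ) with hτ
  have hτ0 : 0 < τ := by positivity
  have hdouble : ∀ n : ℕ, ∃ t, 0 ≤ t ∧ t ≤ τ * ∑ k ∈ Finset.range n, ρ ^ k ∧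
      2 ^ n * A₀ ≤ Y t := by
    intro n
    induction n with
    | zero => exact ⟨0, le_rfl, by simp, by simpa using hY0⟩
    | succ n ih =>
      obtain ⟨t, ht0, ht, hYt⟩ := ih
      refine ⟨t + τ * ρ ^ n, by positivity, ?_, ?_⟩
      · rw [Finset.sum_range_succ, mul_add]
        linarith
      · have hA : A₀ ≤ 2 ^ n * A₀ := by
          have : (1 : ℝ) ≤ 2 ^ n := one_le_pow₀ one_le_two
          nlinarith
        have h1 := linear_growth hY (by linarith) hc H hA₀ hK ht0 hA hYt
          (b := t + τ * ρ ^ n) (by linarith [show 0 < τ * ρ ^ n by positivity])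
        have h2 : (t + τ * ρ ^ n - t) * (c / 2 * (2 ^ n * A₀ / 2) ^ γ) = 2 ^ n * A₀ := by
          have e1 : (2 ^ n * A₀ / 2) ^ γ = (2 ^ γ) ^ n * (A₀ / 2) ^ γ := by
            rw [mul_div_assoc, Real.mul_rpow (by positivity) (by positivity),
              ← Real.rpow_natCast, ← Real.rpow_natCast, ← Real.rpow_mul (by norm_num),
              ← Real.rpow_mul (by norm_num), mul_comm γ]
          rw [e1, hρ, hτ, div_pow]
          field_simp
          ring
        rw [h2] at h1
        rw [pow_succ]
        linarith
  set T : ℝ := τ * (1 - ρ)⁻¹ with hT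
  have hbig : ∀ n : ℕ, 2 ^ n * A₀ ≤ Y T := by
    intro n
    obtain ⟨t, ht0, ht, hYt⟩ := hdouble n
    have htT : t ≤ T := by
      refine ht.trans (mul_le_mul_of_nonneg_left ?_ hτ0.le)
      rw [← tsum_geometric_of_lt_one hρ0.le hρ1]
      exact (summable_geometric_of_lt_one hρ0.le hρ1).sum_le_tsum _ fun k _ => by positivity
    have hA : A₀ ≤ 2 ^ n * A₀ := by
      have : (1 : ℝ) ≤ 2 ^ n := one_le_pow₀ one_le_two
      nlinarith
    have h1 := linear_growth hY (by linarith) hc H hA₀ hK ht0 hA hYt htT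
    have h2 : 0 ≤ (T - t) * (c / 2 * (2 ^ n * A₀ / 2) ^ γ) := by
      have : 0 ≤ T - t := by linarith
      positivity
    linarith
  obtain ⟨n, hn⟩ := pow_unbounded_of_one_lt (Y T / A₀) one_lt_two
  rw [div_lt_iff₀ hA₀] at hn
  exact absurd (hbig n) (not_le.2 hn)

end Blowup

variable {Ω : Set (E N)}

/-! ### Bounds for pairs of slices -/

/-- For slices `(v, A)` and `(w, B)` of the solution at two times, with `v ^ r` exceeding `w ^ r` by
at most `η`, a bound from below for the right-hand side of the weak formulation at the first time,
tested with `w ^ r`. -/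
theorem IsSlice.integral_lower_bound {M p q r η : ℝ} {v w : E N → ℝ} {A B : E N → E N}
    (hv : IsSlice Ω M v A) (hw : IsSlice Ω M w B) (hΩo : IsOpen Ω)
    (hΩb : Bornology.IsBounded Ω) (hM : 0 ≤ M) (hp : 2 ≤ p) (hpq : p < q)
    (hr : r = q / (q - p)) (hη : ∀ x ∈ Ω, v x ^ r - w x ^ r ≤ η) (hη0 : 0 ≤ η) :
    3 / 4 * (∫ x in Ω, v x ^ r * ‖A x‖ ^ q) - 1 / 4 * (∫ x in Ω, w x ^ r * ‖B x‖ ^ q)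
      - (2 * (r * (4 * r) ^ (r - 1)) + η * M ^ q) * volume.real Ω
      ≤ ∫ x in Ω, (-(‖A x‖ ^ (p - 2) * inner ℝ (A x) ((r * w x ^ (r - 1)) • B x))
          + ‖A x‖ ^ q * w x ^ r) := by
  have : IsFiniteMeasure (volume.restrict Ω) := ⟨by simpa using hΩb.measure_lt_top⟩
  have hqp : 0 < q - p := by linarith
  have hr1 : 0 < r - 1 := by
    have : r - 1 = p / (q - p) := by rw [hr]; field_simp; ring
    rw [this]; exact div_pos (by linarith) hqp
  have hr0 : 0 < r := by linarith
  have hAm := hv.aestronglyMeasurable_gradient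
  have hBm := hw.aestronglyMeasurable_gradient
  have i1 := hv.integrable_rpow_mul hΩo hΩb (a := r) (b := q) hr0.le (by linarith)
  have i2 := hw.integrable_rpow_mul hΩo hΩb (a := r) (b := q) hr0.le (by linarith)
  have i3 : IntegrableOn (fun x => -(‖A x‖ ^ (p - 2) * inner ℝ (A x) ((r * w x ^ (r - 1)) • B x))
      + ‖A x‖ ^ q * w x ^ r) Ω := by
    refine Integrable.add (Integrable.neg ?_) ?_
    · refine Integrable.of_bound (C := M ^ (p - 2) * (M * (r * M ^ (r - 1) * M))) ?_ ?_
      · have hwm : AEStronglyMeasurable (fun x => r * w x ^ (r - 1)) (volume.restrict Ω) :=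
          ((Real.continuous_rpow_const hr1.le).comp_aestronglyMeasurable
            hw.aestronglyMeasurable).const_mul r
        exact ((Real.continuous_rpow_const (by linarith)).comp_aestronglyMeasurable hAm.norm).mul
          (hAm.inner (hwm.smul hBm))
      · filter_upwards [hv.ae_bounds hΩo, hw.ae_bounds hΩo] with x hvx hwx
        have c1 := Real.rpow_nonneg hwx.1 (r - 1)
        have c2 := Real.rpow_le_rpow hwx.1 hwx.2.1 hr1.le
        have c3 := Real.rpow_le_rpow (norm_nonneg _) hvx.2.2 (by linarith : 0 ≤ p - 2)
        have c4 := Real.rpow_nonneg hM (p - 2)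
        rw [norm_mul, Real.norm_of_nonneg (Real.rpow_nonneg (norm_nonneg _) _)]
        refine mul_le_mul c3 ((norm_inner_le_norm _ _).trans ?_) (norm_nonneg _) c4
        refine mul_le_mul hvx.2.2 ?_ (norm_nonneg _) hM
        rw [norm_smul, Real.norm_of_nonneg (by positivity)]
        have := hwx.2.2
        gcongr
    · refine Integrable.of_bound (C := M ^ q * M ^ r) ?_ ?_
      · exact ((Real.continuous_rpow_const (by linarith)).comp_aestronglyMeasurable hAm.norm).mul
          ((Real.continuous_rpow_const hr0.le).comp_aestronglyMeasurable hw.aestronglyMeasurable)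
      · filter_upwards [hv.ae_bounds hΩo, hw.ae_bounds hΩo] with x hvx hwx
        rw [norm_mul, Real.norm_of_nonneg (Real.rpow_nonneg (norm_nonneg _) _),
          Real.norm_of_nonneg (Real.rpow_nonneg hwx.1 _)]
        exact mul_le_mul (Real.rpow_le_rpow (norm_nonneg _) hvx.2.2 (by linarith))
          (Real.rpow_le_rpow hwx.1 hwx.2.1 hr0.le) (Real.rpow_nonneg hwx.1 _)
          (Real.rpow_nonneg hM _)
  have i4 : IntegrableOn (fun x => 3 / 4 * (v x ^ r * ‖A x‖ ^ q)
      - 1 / 4 * (w x ^ r * ‖B x‖ ^ q)) Ω := (i1.const_mul _).sub (i2.const_mul _)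
  have e1 : ∫ x in Ω, (3 / 4 * (v x ^ r * ‖A x‖ ^ q) - 1 / 4 * (w x ^ r * ‖B x‖ ^ q)
      - (2 * (r * (4 * r) ^ (r - 1)) + η * M ^ q))
      = 3 / 4 * (∫ x in Ω, v x ^ r * ‖A x‖ ^ q) - 1 / 4 * (∫ x in Ω, w x ^ r * ‖B x‖ ^ q)
      - (2 * (r * (4 * r) ^ (r - 1)) + η * M ^ q) * volume.real Ω := by
    rw [integral_sub i4 (integrable_const _),
      integral_sub (i1.const_mul _) (i2.const_mul _), integral_const_mul, integral_const_mul,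
      setIntegral_const, smul_eq_mul]
    ring
  rw [← e1]
  refine integral_mono_ae (i4.sub (integrable_const _)) i3 ?_
  filter_upwards [ae_restrict_mem hΩo.measurableSet, hv.ae_bounds hΩo, hw.ae_bounds hΩo]
    with x hx hvx hwx
  have h1 := weak_integrand_lower_bound hp hpq hr hwx.1 (A x) (B x)
  have h2 := hη x hx
  have h3 : ‖A x‖ ^ q ≤ M ^ q := Real.rpow_le_rpow (norm_nonneg _) hvx.2.2 (by linarith)
  have h4 : 0 ≤ ‖A x‖ ^ q := Real.rpow_nonneg (norm_nonneg _) _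
  have h5 : (v x ^ r - w x ^ r) * ‖A x‖ ^ q ≤ η * M ^ q :=
    (mul_le_mul_of_nonneg_right h2 h4).trans (mul_le_mul_of_nonneg_left h3 hη0)
  have h6 : 0 ≤ η * M ^ q := by
    have := Real.rpow_nonneg hM q
    positivity
  linarith

/-- The tangent line inequality for the convex function `s ↦ s ^ (r + 1)`. -/
theorem rpow_tangent_le {r w y : ℝ} (hr : 0 < r) (hw : 0 ≤ w) (hy : 0 ≤ y) :
    (r + 1) * ((y - w) * w ^ r) ≤ y ^ (r + 1) - w ^ (r + 1) := by
  rcases hw.eq_or_lt with h | hw0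
  · rw [← h, Real.zero_rpow hr.ne', Real.zero_rpow (by linarith)]
    have := Real.rpow_nonneg hy (r + 1)
    simpa using this
  · have h1 := one_add_mul_self_le_rpow_one_add (s := y / w - 1) (p := r + 1)
      (by have : 0 ≤ y / w := by positivity
          linarith) (by linarith)
    have h2 : (1 + (y / w - 1)) ^ (r + 1) = y ^ (r + 1) / w ^ (r + 1) := by
      rw [add_sub_cancel, Real.div_rpow hy hw]
    have h3 : 0 < w ^ (r + 1) := Real.rpow_pos_of_pos hw0 _
    rw [h2, le_div_iff₀ h3] at h1
    have h4 : w ^ (r + 1) = w ^ r * w := Real.rpow_add_one hw0.ne' r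
    have h5 : (1 + (r + 1) * (y / w - 1)) * w ^ (r + 1)
        = w ^ (r + 1) + (r + 1) * ((y - w) * w ^ r) := by
      rw [h4]; field_simp
    linarith

/-- A substitute for Jensen's inequality, linear in the integrands. -/
theorem rpow_ge_affine {r q w l : ℝ} (hr : 0 < r) (hq : 1 < q) (hw : 0 ≤ w) (hl : 0 ≤ l) :
    l ^ (q - 1) * (w ^ (r + 1) - l ^ (r + 1)) ≤ w ^ (r + q) := by
  have h0 := Real.rpow_nonneg hw (r + q)
  have h1 := Real.rpow_nonneg hl (q - 1)
  have h2 := Real.rpow_nonneg hw (r + 1)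
  have h3 := Real.rpow_nonneg hl (r + 1)
  rcases le_total w l with h | h
  · have := Real.rpow_le_rpow hw h (by linarith : 0 ≤ r + 1)
    nlinarith
  · have e : w ^ (r + q) = w ^ (q - 1) * w ^ (r + 1) := by
      rw [← Real.rpow_add_of_nonneg hw (by linarith) (by linarith)]; ring_nf
    have := Real.rpow_le_rpow hl h (by linarith : 0 ≤ q - 1)
    rw [e]
    nlinarith

/-! ### Continuity and measurability in time -/

section Solution

variable {u : ℝ → E N → ℝ} {Du : ℝ → E N → E N}

theorem eq_zero_of_mem_frontier
    (hc : ContinuousOn (uncurry u) (Ici (0 : ℝ) ×ˢ closure Ω))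
    (hz : ∀ t, 0 < t → ∀ x ∈ frontier Ω, u t x = 0) {t : ℝ} (ht : 0 ≤ t) {x : E N}
    (hx : x ∈ frontier Ω) : u t x = 0 := by
  rcases ht.eq_or_lt with h | h
  · rw [← h]
    have h1 : ContinuousOn (fun s => u s x) (Ici 0) :=
      hc.comp (f := fun s : ℝ => (s, x)) (by fun_prop)
        fun s hs => ⟨hs, frontier_subset_closure hx⟩
    have h2 : Tendsto (fun s => u s x) (𝓝[>] 0) (𝓝 (u 0 x)) :=
      (h1 0 self_mem_Ici).mono_left (nhdsWithin_mono _ Ioi_subset_Ici_self)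
    refine tendsto_nhds_unique h2 (tendsto_const_nhds.congr' ?_)
    filter_upwards [self_mem_nhdsWithin] with s hs
    exact (hz s hs x hx).symm
  · exact hz t h x hx

/-- Powers of the solution, extended by zero in space and by a constant to negative times, are
jointly continuous. -/
theorem continuous_indicator_rpow
    (hc : ContinuousOn (uncurry u) (Ici (0 : ℝ) ×ˢ closure Ω))
    (hz : ∀ t, 0 < t → ∀ x ∈ frontier Ω, u t x = 0) {a : ℝ} (ha : 0 < a) :
    Continuous fun z : ℝ × E N => Ω.indicator (fun x => u (max z.1 0) x ^ a) z.2 := by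
  classical
  have e : (fun z : ℝ × E N => Ω.indicator (fun x => u (max z.1 0) x ^ a) z.2)
      = (univ ×ˢ Ω).piecewise (fun z => u (max z.1 0) z.2 ^ a) 0 := by
    ext z
    by_cases hz : z.2 ∈ Ω <;> simp [hz, piecewise]
  rw [e]
  refine continuous_piecewise ?_ ?_ continuousOn_const
  · intro z hzf
    rw [frontier_univ_prod_eq] at hzf
    simp only [Pi.zero_apply]
    rw [eq_zero_of_mem_frontier hc hz (le_max_right _ _) hzf.2, Real.zero_rpow ha.ne']
  · rw [closure_prod_eq, closure_univ]
    refine ContinuousOn.rpow_const ?_ fun _ _ => Or.inr ha.le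
    exact hc.comp (f := fun z : ℝ × E N => (max z.1 0, z.2)) (by fun_prop)
      fun z hz => ⟨mem_Ici.2 (le_max_right _ _), hz.2⟩

theorem continuous_integral_rpow (hΩo : IsOpen Ω) (hΩb : Bornology.IsBounded Ω)
    (hc : ContinuousOn (uncurry u) (Ici (0 : ℝ) ×ˢ closure Ω))
    (hz : ∀ t, 0 < t → ∀ x ∈ frontier Ω, u t x = 0) {a : ℝ} (ha : 0 < a) :
    Continuous fun t => ∫ x in Ω, u (max t 0) x ^ a := by
  have h := continuous_parametric_integral_of_continuous (μ := (volume : Measure (E N)))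
    (f := fun (t : ℝ) x => Ω.indicator (fun x => u (max t 0) x ^ a) x)
    (continuous_indicator_rpow hc hz ha) hΩb.isCompact_closure
  refine h.congr fun t => ?_
  rw [setIntegral_indicator hΩo.measurableSet, inter_eq_self_of_subset_right subset_closure]

/-- Uniform continuity in time, uniformly in space, of powers of the solution. -/
theorem exists_forall_rpow_sub_le (hΩb : Bornology.IsBounded Ω)
    (hc : ContinuousOn (uncurry u) (Ici (0 : ℝ) ×ˢ closure Ω))
    (hz : ∀ t, 0 < t → ∀ x ∈ frontier Ω, u t x = 0) {a : ℝ} (ha : 0 < a) (T : ℝ) {η : ℝ}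
    (hη : 0 < η) : ∃ d > 0, ∀ t ∈ Icc 0 T, ∀ s ∈ Icc 0 T, |s - t| < d → ∀ x ∈ Ω,
      u s x ^ a - u t x ^ a ≤ η := by
  have hK : IsCompact (Icc 0 T ×ˢ closure Ω) := isCompact_Icc.prod hΩb.isCompact_closure
  have huc := hK.uniformContinuousOn_of_continuous
    (continuous_indicator_rpow hc hz ha).continuousOn
  obtain ⟨d, hd, H⟩ := Metric.uniformContinuousOn_iff.1 huc η hη
  refine ⟨d, hd, fun t ht s hs hst x hx => ?_⟩
  have h1 := H (s, x) ⟨hs, subset_closure hx⟩ (t, x) ⟨ht, subset_closure hx⟩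
    (by simpa [Prod.dist_eq, Real.dist_eq, hd] using hst)
  simp only [hx, indicator_of_mem, max_eq_left hs.1, max_eq_left ht.1, Real.dist_eq] at h1
  exact (le_abs_self _).trans h1.le

/-- On bounded time intervals, almost every time slice of a solution is a slice in the sense of
`IsSlice`, with a uniform bound. -/
theorem exists_ae_isSlice (hΩb : Bornology.IsBounded Ω)
    (hc : ContinuousOn (uncurry u) (Ici (0 : ℝ) ×ˢ closure Ω))
    (hnn : ∀ t, 0 ≤ t → ∀ x ∈ closure Ω, 0 ≤ u t x)
    (hz : ∀ t, 0 < t → ∀ x ∈ frontier Ω, u t x = 0)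
    (hD : MemLinftyW1infty Ω u Du) {T : ℝ} (hT : 0 < T) :
    ∃ M : ℝ, 0 ≤ M ∧ ∀ᵐ t ∂(volume.restrict (Ioo 0 T)), IsSlice Ω M (u t) (Du t) := by
  have hK : IsCompact (Icc 0 T ×ˢ closure Ω) := isCompact_Icc.prod hΩb.isCompact_closure
  obtain ⟨C, hC⟩ := hK.exists_bound_of_continuousOn
    (hc.mono (prod_mono Icc_subset_Ici_self subset_rfl))
  obtain ⟨M, hM⟩ := hD.2.2 T hT
  refine ⟨max (max M C) 0, le_max_right _ _, ?_⟩
  filter_upwards [hM, ae_restrict_mem measurableSet_Ioo] with t ht htT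
  have h1 : ContinuousOn (u t) (closure Ω) :=
    hc.comp (f := fun x : E N => (t, x)) (by fun_prop) fun x hx => ⟨htT.1.le, hx⟩
  refine ⟨h1, hnn t htT.1.le, hz t htT.1, ht.1, fun x hx => ?_, ?_⟩
  · have h2 := hC (t, x) ⟨⟨htT.1.le, htT.2.le⟩, hx⟩
    exact (le_abs_self _).trans (h2.trans ((le_max_right _ _).trans (le_max_left _ _)))
  · filter_upwards [ht.2] with x hx
    exact hx.2.trans ((le_max_left _ _).trans (le_max_left _ _))

theorem aestronglyMeasurable_integral_rpow_mul
    (hD : MemLinftyW1infty Ω u Du) {a b : ℝ} (ha : 0 ≤ a) (hb : 0 ≤ b) :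
    AEStronglyMeasurable (fun t => ∫ x in Ω, u t x ^ a * ‖Du t x‖ ^ b)
      (volume.restrict (Ioi (0 : ℝ))) := by
  have e : (volume : Measure (ℝ × E N)).restrict (Ioi (0 : ℝ) ×ˢ Ω)
      = (volume.restrict (Ioi (0 : ℝ))).prod (volume.restrict Ω) := by
    rw [Measure.prod_restrict, Measure.volume_eq_prod]
  have h1 := hD.1
  have h2 := hD.2.1
  rw [e] at h1 h2
  exact (((Real.continuous_rpow_const ha).comp_aestronglyMeasurable h1).mul
    ((Real.continuous_rpow_const hb).comp_aestronglyMeasurable h2.norm)).integral_prod_right'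

/-- The weak formulation, integrated in time. -/
theorem integral_eq_sub_of_weak {ψ : E N → ℝ} {g : ℝ → ℝ} {T : ℝ}
    (hac : AbsolutelyContinuousOnInterval (fun t => ∫ x in Ω, u t x * ψ x) 0 T)
    (hd : ∀ᵐ t ∂(volume.restrict (Ioo 0 T)),
      HasDerivAt (fun s => ∫ x in Ω, u s x * ψ x) (g t) t) {a b : ℝ} (ha : 0 ≤ a) (hab : a ≤ b)
    (hb : b ≤ T) :
    IntervalIntegrable g volume a b ∧
      ∫ t in a..b, g t = (∫ x in Ω, u b x * ψ x) - ∫ x in Ω, u a x * ψ x := by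
  have hac' := hac.mono (c := a) (d := b) (by
    rw [uIcc_of_le hab, uIcc_of_le (ha.trans (hab.trans hb))]
    exact Icc_subset_Icc ha hb)
  have hd' : ∀ᵐ t, t ∈ uIoc a b → deriv (fun s => ∫ x in Ω, u s x * ψ x) t = g t := by
    have h1 := (ae_restrict_iff' measurableSet_Ioo).1 hd
    have h2 : ∀ᵐ t : ℝ, t ≠ T := by simp [ae_iff]
    filter_upwards [h1, h2] with t ht htT hmem
    rw [uIoc_of_le hab] at hmem
    exact (ht ⟨ha.trans_lt hmem.1, lt_of_le_of_ne (hmem.2.trans hb) htT⟩).deriv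
  refine ⟨hac'.intervalIntegrable_deriv.congr_ae ?_, ?_⟩
  · exact (ae_restrict_iff' measurableSet_uIoc).2 hd'
  · rw [← hac'.integral_deriv_eq_sub]
    exact (intervalIntegral.integral_congr_ae hd').symm

end Solution

/-! ### The energy inequality -/

/-- Testing the increment of the solution with `w ^ r` bounds the increment of `∫ u ^ (r + 1)`
from below, by convexity. -/
theorem integral_mul_rpow_sub_le (hΩo : IsOpen Ω) (hΩb : Bornology.IsBounded Ω) {v w : E N → ℝ}
    {r : ℝ} (hr : 0 < r) (hv : ContinuousOn v (closure Ω)) (hw : ContinuousOn w (closure Ω))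
    (hv0 : ∀ x ∈ closure Ω, 0 ≤ v x) (hw0 : ∀ x ∈ closure Ω, 0 ≤ w x) :
    (∫ x in Ω, v x * w x ^ r) - ∫ x in Ω, w x * w x ^ r ≤
      (r + 1)⁻¹ * (∫ x in Ω, v x ^ (r + 1)) - (r + 1)⁻¹ * ∫ x in Ω, w x ^ (r + 1) := by
  have hi : ∀ {f : E N → ℝ}, ContinuousOn f (closure Ω) → IntegrableOn f Ω := fun hf =>
    (hf.integrableOn_compact hΩb.isCompact_closure).mono_set subset_closure
  have hp : ∀ {f : E N → ℝ} {a : ℝ}, 0 < a → ContinuousOn f (closure Ω) →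
      ContinuousOn (fun x => f x ^ a) (closure Ω) := fun ha hf =>
    hf.rpow_const fun _ _ => Or.inr ha.le
  have i1 : IntegrableOn (fun x => v x * w x ^ r) Ω := hi (hv.mul (hp hr hw))
  have i2 : IntegrableOn (fun x => w x * w x ^ r) Ω := hi (hw.mul (hp hr hw))
  have i3 := hi (hp (by linarith : 0 < r + 1) hv)
  have i4 := hi (hp (by linarith : 0 < r + 1) hw)
  rw [← mul_sub, ← integral_sub i1 i2, ← integral_sub i3 i4, ← integral_const_mul]
  refine setIntegral_mono_on (i1.sub i2) ((i3.sub i4).const_mul _) hΩo.measurableSet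
    fun x hx => ?_
  have h1 := rpow_tangent_le hr (hw0 x (subset_closure hx)) (hv0 x (subset_closure hx))
  rw [inv_mul_eq_div, le_div_iff₀ (by linarith)]
  linarith

/-- The energy inequality: the formal identity obtained by testing the equation with `u ^ r`, where
`r = q / (q - p)`, with the diffusion term absorbed into half of the source term. -/
theorem energy_inequality {u : ℝ → E N → ℝ} {Du : ℝ → E N → E N} {p q r : ℝ} (hΩo : IsOpen Ω)
    (hΩb : Bornology.IsBounded Ω) (hp : 2 ≤ p) (hpq : p < q) (hr : r = q / (q - p))
    (hc : ContinuousOn (uncurry u) (Ici (0 : ℝ) ×ˢ closure Ω))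
    (hnn : ∀ t, 0 ≤ t → ∀ x ∈ closure Ω, 0 ≤ u t x)
    (hz : ∀ t, 0 < t → ∀ x ∈ frontier Ω, u t x = 0)
    (hD : MemLinftyW1infty Ω u Du)
    (hweak : ∀ (ψ : E N → ℝ) (Dψ : E N → E N), MemH10 Ω ψ Dψ → ∀ T : ℝ, 0 < T →
      AbsolutelyContinuousOnInterval (fun t => ∫ x in Ω, u t x * ψ x) 0 T ∧
      ∀ᵐ t ∂(volume.restrict (Ioo 0 T)),
        HasDerivAt (fun s => ∫ x in Ω, u s x * ψ x)
          (∫ x in Ω, (- (‖Du t x‖ ^ (p - 2) * inner ℝ (Du t x) (Dψ x)) + ‖Du t x‖ ^ q * ψ x)) t)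
    {a b : ℝ} (ha : 0 ≤ a) (hab : a ≤ b) :
    IntervalIntegrable (fun t => ∫ x in Ω, u t x ^ r * ‖Du t x‖ ^ q) volume a b ∧
    1 / 2 * (∫ t in a..b, ∫ x in Ω, u t x ^ r * ‖Du t x‖ ^ q)
      - 2 * (r * (4 * r) ^ (r - 1)) * volume.real Ω * (b - a)
      ≤ (r + 1)⁻¹ * (∫ x in Ω, u (max b 0) x ^ (r + 1))
        - (r + 1)⁻¹ * ∫ x in Ω, u (max a 0) x ^ (r + 1) := by
  have : IsFiniteMeasure (volume.restrict Ω) := ⟨by simpa using hΩb.measure_lt_top⟩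
  have hqp : 0 < q - p := by linarith
  have hr1 : 1 < r := by rw [hr, one_lt_div hqp]; linarith
  have hr0 : 0 < r := by linarith
  have hq0 : 0 < q := by linarith
  have hcont : ∀ t, 0 ≤ t → ContinuousOn (u t) (closure Ω) := fun t ht =>
    hc.comp (f := fun x : E N => (t, x)) (by fun_prop) fun x hx => ⟨ht, hx⟩
  set T : ℝ := b + 1 with hT
  have hT0 : 0 < T := by linarith
  obtain ⟨M, hM, hslice⟩ := exists_ae_isSlice hΩb hc hnn hz hD hT0
  have hslice' := (ae_restrict_iff' measurableSet_Ioo).1 hslice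
  set B : ℝ → ℝ := fun t => ∫ x in Ω, u t x ^ r * ‖Du t x‖ ^ q with hB
  have hBi : IntegrableOn B (Ioo 0 T) := by
    refine Integrable.of_bound (C := M ^ r * M ^ q * volume.real Ω) ?_ ?_
    · exact (aestronglyMeasurable_integral_rpow_mul hD hr0.le hq0.le).mono_measure
        (Measure.restrict_mono Ioo_subset_Ioi_self le_rfl)
    · filter_upwards [hslice] with t ht
      refine norm_setIntegral_le_of_norm_le_const_ae' hΩb.measure_lt_top ?_
      rw [← ae_restrict_iff' hΩo.measurableSet]
      filter_upwards [ht.ae_bounds hΩo] with x hx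
      rw [norm_mul, Real.norm_of_nonneg (Real.rpow_nonneg hx.1 _),
        Real.norm_of_nonneg (Real.rpow_nonneg (norm_nonneg _) _)]
      exact mul_le_mul (Real.rpow_le_rpow hx.1 hx.2.1 hr0.le)
        (Real.rpow_le_rpow (norm_nonneg _) hx.2.2 hq0.le)
        (Real.rpow_nonneg (norm_nonneg _) _) (Real.rpow_nonneg hM _)
  have hBI : Integrable ((Ioo 0 T).indicator B) :=
    (integrable_indicator_iff measurableSet_Ioo).2 hBi
  have hsub : Ioc a b ⊆ Ioo 0 T := fun t ht => ⟨ha.trans_lt ht.1, by linarith [ht.2]⟩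
  have hYc : Continuous fun t => (r + 1)⁻¹ * ∫ x in Ω, u (max t 0) x ^ (r + 1) :=
    continuous_const.mul (continuous_integral_rpow hΩo hΩb hc hz (by linarith))
  have main := integral_le_sub_of_ae_difference (K := 2 * (r * (4 * r) ^ (r - 1)) * volume.real Ω)
    hab hYc hBI ?_
  · have e : ∫ t in a..b, (Ioo 0 T).indicator B t = ∫ t in a..b, B t := by
      rw [intervalIntegral.integral_of_le hab, intervalIntegral.integral_of_le hab]
      exact setIntegral_congr_fun measurableSet_Ioc fun t ht => indicator_of_mem (hsub ht) B
    rw [e] at main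
    exact ⟨(intervalIntegrable_iff_integrableOn_Ioc_of_le hab).2 (hBi.mono_set hsub), main⟩
  intro δ hδ
  have hMq : 0 ≤ M ^ q * volume.real Ω := mul_nonneg (Real.rpow_nonneg hM _) measureReal_nonneg
  set η := δ / (M ^ q * volume.real Ω + 1) with hη
  have hη0 : 0 < η := by positivity
  have hηδ : η * (M ^ q * volume.real Ω) ≤ δ := by
    rw [hη, div_mul_eq_mul_div, div_le_iff₀ (by positivity)]
    nlinarith
  obtain ⟨d, hd, hclose⟩ := exists_forall_rpow_sub_le hΩb hc hz hr0 T hη0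
  filter_upwards [Ioo_mem_nhdsGT (lt_min hd one_pos)] with h hh
  have hh0 : 0 < h := hh.1
  have hhd : h < d := hh.2.trans_le (min_le_left _ _)
  have hh1 : h < 1 := hh.2.trans_le (min_le_right _ _)
  filter_upwards [hslice'] with t hst ht
  have htT := hsub ht
  have hst := hst htT
  have ht0 : 0 ≤ t := htT.1.le
  have hthT : t + h ≤ T := by linarith [ht.2]
  obtain ⟨hac, hder⟩ := hweak _ _ (hst.memH10_rpow hΩo hΩb hM hr1) T hT0
  obtain ⟨hgi, hge⟩ := integral_eq_sub_of_weak hac hder ht0 (by linarith : t ≤ t + h) hthT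
  have hconv := integral_mul_rpow_sub_le hΩo hΩb hr0 (hcont (t + h) (by linarith)) (hcont t ht0)
    (hnn (t + h) (by linarith)) (hnn t ht0)
  rw [max_eq_left ht0, max_eq_left (by linarith : 0 ≤ t + h)]
  refine le_trans ?_ hconv
  rw [← hge]
  set k : ℝ := 1 / 4 * (Ioo 0 T).indicator B t + 2 * (r * (4 * r) ^ (r - 1)) * volume.real Ω + δ
    with hk
  have e1 : 3 / 4 * (∫ s in t..t + h, (Ioo 0 T).indicator B s) - h * k
      = ∫ s in t..t + h, (3 / 4 * (Ioo 0 T).indicator B s - k) := by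
    rw [intervalIntegral.integral_sub (hBI.intervalIntegrable.const_mul _)
      intervalIntegrable_const, intervalIntegral.integral_const_mul,
      intervalIntegral.integral_const, smul_eq_mul]
    ring
  rw [e1, intervalIntegral.integral_of_le (by linarith), intervalIntegral.integral_of_le
    (by linarith)]
  have h2 : ∀ᵐ s : ℝ, s ≠ T := by simp [ae_iff]
  refine setIntegral_mono_on_ae
    ((hBI.intervalIntegrable.const_mul _).sub intervalIntegrable_const).1 hgi.1 measurableSet_Ioc ?_
  filter_upwards [hslice', h2] with s hss hsT hs
  have hs0T : s ∈ Ioo 0 T := ⟨ht0.trans_lt hs.1, lt_of_le_of_ne (hs.2.trans hthT) hsT⟩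
  have hss := hss hs0T
  have hcl := hclose t ⟨ht0, htT.2.le⟩ s ⟨hs0T.1.le, hs0T.2.le⟩
    (by rw [abs_of_pos (sub_pos.2 hs.1)]; linarith [hs.2])
  have hlow := hss.integral_lower_bound hst hΩo hΩb hM hp hpq hr hcl hη0.le
  refine le_trans ?_ hlow
  rw [hk, indicator_of_mem hs0T, indicator_of_mem htT]
  simp only [hB]
  linarith

/-- The source term dominates a superlinear power of the energy, by the weighted Poincaré
inequality. -/
theorem IsSlice.integral_source_ge {M q r R V A : ℝ} {v : E N → ℝ} {G : E N → E N}
    (h : IsSlice Ω M v G) (hN : 1 ≤ N) (hΩo : IsOpen Ω) (hM : 0 ≤ M) (hR0 : 0 < R)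
    (hR : ∀ x ∈ Ω, ‖x‖ ≤ R) (hr : 0 < r) (hq : 1 < q) (hV0 : 0 < V) (hV : volume.real Ω ≤ V)
    (hA : 0 ≤ A) (hvA : A ≤ (r + 1)⁻¹ * ∫ x in Ω, v x ^ (r + 1)) :
    (2 * (2 * R * (r + q)) ^ q)⁻¹ * ((r + 1) / 2 * ((r + 1) / (2 * V)) ^ ((q - 1) / (r + 1)))
      * A ^ (1 + (q - 1) / (r + 1)) ≤ ∫ x in Ω, v x ^ r * ‖G x‖ ^ q := by
  have hΩb : Bornology.IsBounded Ω := isBounded_iff_forall_norm_le.2 ⟨R, hR⟩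
  have : IsFiniteMeasure (volume.restrict Ω) := ⟨by simpa using hΩb.measure_lt_top⟩
  have hP := h.integral_rpow_le hN hΩo hM hR0 hR hq (by linarith : q < r + q)
  rw [add_sub_cancel_right] at hP
  -- the level at which the affine minorant of `w ^ (r + q)` is taken
  set l : ℝ := ((r + 1) / (2 * V) * A) ^ (r + 1)⁻¹ with hl
  have hbase : 0 ≤ (r + 1) / (2 * V) * A := by positivity
  have hl0 : 0 ≤ l := Real.rpow_nonneg hbase _
  have hl1 : l ^ (r + 1) = (r + 1) / (2 * V) * A := by
    rw [hl, ← Real.rpow_mul hbase, inv_mul_cancel₀ (by linarith), Real.rpow_one]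
  have hl2 : l ^ (q - 1) = ((r + 1) / (2 * V)) ^ ((q - 1) / (r + 1)) * A ^ ((q - 1) / (r + 1)) := by
    rw [hl, ← Real.rpow_mul hbase, ← Real.mul_rpow (by positivity) hA]
    congr 1
    field_simp
  have hlq : 0 ≤ l ^ (q - 1) := Real.rpow_nonneg hl0 _
  have i1 := h.integrable_rpow hΩo hΩb (a := r + 1) (by linarith)
  have i2 := h.integrable_rpow hΩo hΩb (a := r + q) (by linarith)
  have hJ : l ^ (q - 1) * ((∫ x in Ω, v x ^ (r + 1)) - l ^ (r + 1) * volume.real Ω)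
      ≤ ∫ x in Ω, v x ^ (r + q) := by
    have e : l ^ (q - 1) * ((∫ x in Ω, v x ^ (r + 1)) - l ^ (r + 1) * volume.real Ω)
        = ∫ x in Ω, l ^ (q - 1) * (v x ^ (r + 1) - l ^ (r + 1)) := by
      rw [integral_const_mul, integral_sub i1 (integrable_const _), setIntegral_const, smul_eq_mul]
      ring
    rw [e]
    refine setIntegral_mono_on ((i1.sub (integrable_const _)).const_mul _) i2 hΩo.measurableSet
      fun x hx => rpow_ge_affine hr hq (h.nonneg x (subset_closure hx)) hl0
  have hv : (r + 1) * A ≤ ∫ x in Ω, v x ^ (r + 1) := by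
    rw [inv_mul_eq_div, le_div_iff₀ (by linarith)] at hvA
    linarith
  have hhalf : (r + 1) / 2 * A ≤ (∫ x in Ω, v x ^ (r + 1)) - l ^ (r + 1) * volume.real Ω := by
    have h1 : l ^ (r + 1) * volume.real Ω ≤ (r + 1) / (2 * V) * A * V := by
      rw [hl1]; gcongr
    have h2 : (r + 1) / (2 * V) * A * V = (r + 1) / 2 * A := by field_simp
    linarith
  have hc : 0 < 2 * (2 * R * (r + q)) ^ q := by
    have : 0 < 2 * R * (r + q) := by positivity
    positivity
  rw [mul_assoc, inv_mul_le_iff₀ hc]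
  refine le_trans (le_trans (le_of_eq ?_) (mul_le_mul_of_nonneg_left hhalf hlq)) (hJ.trans hP)
  rw [hl2, Real.rpow_add_of_nonneg hA zero_le_one (div_nonneg (by linarith) (by linarith)),
    Real.rpow_one]
  ring

end GradSource

/-! ### Nonexistence -/

theorem proposition5p3 (N : ℕ) (hN : 1 ≤ N) (Ω : Set (GradSource.E N))
    (hΩo : IsOpen Ω) (hΩc : IsConnected Ω) (hΩb : Bornology.IsBounded Ω)
    (hΩ2 : GradSource.HasC2Boundary Ω) (p q : ℝ) (hp : 2 ≤ p) (hpq : p < q) :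
    ∃ κ : ℝ, 0 < κ ∧ ∀ u₀ : GradSource.E N → ℝ,
      ContinuousOn u₀ (closure Ω) → (∀ x ∈ closure Ω, 0 ≤ u₀ x) →
      (∀ x ∈ frontier Ω, u₀ x = 0) →
      ENNReal.ofReal κ <
        eLpNorm u₀ (ENNReal.ofReal (q / (q - p) + 1)) (volume.restrict Ω) →
      ¬ ∃ u : ℝ → GradSource.E N → ℝ, GradSource.IsGlobalWeakSolution Ω p q u₀ u := by
  obtain ⟨R', hR'⟩ := isBounded_iff_forall_norm_le.1 hΩb
  set R : ℝ := max R' 1 with hRdef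
  have hR0 : 0 < R := lt_max_of_lt_right one_pos
  have hR : ∀ x ∈ Ω, ‖x‖ ≤ R := fun x hx => (hR' x hx).trans (le_max_left _ _)
  have hfin : IsFiniteMeasure (volume.restrict Ω) := ⟨by simpa using hΩb.measure_lt_top⟩
  set r : ℝ := q / (q - p) with hr
  have hr0 : 0 < r := div_pos (by linarith) (by linarith)
  set V : ℝ := volume.real Ω + 1 with hVdef
  have hVn : 0 ≤ volume.real Ω := measureReal_nonneg
  have hV0 : 0 < V := by linarith
  set γ : ℝ := 1 + (q - 1) / (r + 1) with hγdef
  have hγ : 1 < γ := by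
    have : 0 < (q - 1) / (r + 1) := div_pos (by linarith) (by linarith)
    linarith
  set c₀ : ℝ := (2 * (2 * R * (r + q)) ^ q)⁻¹ *
    ((r + 1) / 2 * ((r + 1) / (2 * V)) ^ ((q - 1) / (r + 1))) with hc₀def
  have hc₀ : 0 < c₀ := by
    have h1 : 0 < 2 * R * (r + q) := by
      have : 0 < r + q := by linarith
      positivity
    positivity
  set c : ℝ := 1 / 2 * c₀ with hcdef
  have hc : 0 < c := by positivity
  set K : ℝ := 2 * (r * (4 * r) ^ (r - 1)) * volume.real Ω with hKdef
  have hK0 : 0 ≤ K := by positivity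
  -- above this energy level the superlinear growth beats the constant `K`
  set A₀ : ℝ := 2 * (1 + 2 * K / c) with hA₀def
  have hA₀ : 0 < A₀ := by positivity
  have hKA : K ≤ c / 2 * (A₀ / 2) ^ γ := by
    have h1 : A₀ / 2 = 1 + 2 * K / c := by rw [hA₀def]; ring
    have h2 : (1 : ℝ) ≤ 1 + 2 * K / c := by
      have : 0 ≤ 2 * K / c := by positivity
      linarith
    have h3 : 1 + 2 * K / c ≤ (1 + 2 * K / c) ^ γ := Real.self_le_rpow_of_one_le h2 hγ.le
    rw [h1]
    calc K = c / 2 * (2 * K / c) := by field_simp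
      _ ≤ c / 2 * (1 + 2 * K / c) ^ γ := by
        gcongr
        linarith
  refine ⟨((r + 1) * A₀) ^ (r + 1)⁻¹, by positivity, ?_⟩
  rintro u₀ hu₀c hu₀n - hlarge ⟨u, hc', hnn, hz, hinit, Du, hD, hweak⟩
  set Y : ℝ → ℝ := fun t => (r + 1)⁻¹ * ∫ x in Ω, u (max t 0) x ^ (r + 1) with hY
  have hYc : Continuous Y := continuous_const.mul
    (GradSource.continuous_integral_rpow hΩo hΩb hc' hz (by linarith))
  have hlt : Y 0 < A₀ := by
    refine GradSource.blowup (K := K) hYc hγ hc ?_ hA₀ hKA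
    intro a b A ha hab hA hYA
    obtain ⟨hBi, hE⟩ := GradSource.energy_inequality hΩo hΩb hp hpq hr hc' hnn hz hD hweak ha hab
    obtain ⟨M, hM, hslice⟩ := GradSource.exists_ae_isSlice hΩb hc' hnn hz hD
      (by linarith : 0 < b + 1)
    have h1 : ∫ _ in a..b, c₀ * A ^ γ ≤ ∫ t in a..b, ∫ x in Ω, u t x ^ r * ‖Du t x‖ ^ q := by
      rw [intervalIntegral.integral_of_le hab, intervalIntegral.integral_of_le hab]
      refine setIntegral_mono_on_ae (integrableOn_const measure_Ioc_lt_top.ne) hBi.1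
        measurableSet_Ioc ?_
      filter_upwards [(ae_restrict_iff' measurableSet_Ioo).1 hslice] with t hst ht
      have ht0 : 0 < t := ha.trans_lt ht.1
      have hvA := hYA t ⟨ht.1.le, ht.2⟩
      simp only [hY, max_eq_left ht0.le] at hvA
      exact (hst ⟨ht0, by linarith [ht.2]⟩).integral_source_ge hN hΩo hM hR0 hR hr0
        (by linarith) hV0 (by linarith) hA hvA
    rw [intervalIntegral.integral_const, smul_eq_mul] at h1
    refine le_trans ?_ hE
    have h2 : (b - a) * (c * A ^ γ - K) = 1 / 2 * ((b - a) * (c₀ * A ^ γ)) - K * (b - a) := by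
      rw [hcdef]; ring
    rw [h2]
    linarith
  have h0 : ∫ x in Ω, ‖u₀ x‖ ^ (r + 1) = (r + 1) * Y 0 := by
    simp only [hY, max_self]
    rw [mul_inv_cancel_left₀ (by linarith)]
    refine setIntegral_congr_fun hΩo.measurableSet fun x hx => ?_
    rw [hinit x hx, Real.norm_of_nonneg (hu₀n x (subset_closure hx))]
  obtain ⟨C, hC⟩ := hΩb.isCompact_closure.exists_bound_of_continuousOn hu₀c
  have hmem : MemLp u₀ (ENNReal.ofReal (r + 1)) (volume.restrict Ω) := by
    refine MemLp.of_bound ((hu₀c.mono subset_closure).aestronglyMeasurable hΩo.measurableSet) C ?_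
    filter_upwards [ae_restrict_mem hΩo.measurableSet] with x hx using hC x (subset_closure hx)
  rw [hmem.eLpNorm_eq_integral_rpow_norm (by simp; linarith) (by simp),
    ENNReal.toReal_ofReal (by linarith), h0] at hlarge
  have hY0 : 0 ≤ (r + 1) * Y 0 := by
    rw [← h0]
    exact integral_nonneg fun x => Real.rpow_nonneg (norm_nonneg _) _
  refine absurd hlarge (not_lt.2 (ENNReal.ofReal_le_ofReal ?_))
  refine Real.rpow_le_rpow hY0 ?_ (by positivity)
  gcongr
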